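/- **Setting.** For $z\in\mathbb C$ let $D_2(z)=\arg(1-z)\log|z|+\operatorname{Im}\mathrm{Li}_2(z)$, where $\mathrm{Li}_2(z)=-\int_0^z\log(1-t)\,\frac{dt}{t}$, be the Bloch–Wigner dilogarithm, extended continuously to $\mathbb P^1=\mathbb C\cup\{\infty\}$ by $D_2(0)=D_2(1)=D_2(\infty)=0$, and let $\mathcal L_2=\sqrt{-1}\,D_2$. The cross-ratio of four points of $\mathbb P^1$ is $$[a:b:c:d]=\frac{(a-b)(c-d)}{(a-c)(b-d)},\qquad\text{so that}\quad [z:b:c:\infty]=\frac{z-b}{z-c};$$ for degenerate quadruples for which it is undefined, $D_2([a:b:c:d])$ is taken to be $0$. Let $\Gamma\subset \mathrm{PSL}_2(\mathbb C)$ be a Kleinian group of the second kind, that is, a subgroup whose region of discontinuity $U_\Gamma\subset\mathbb P^1$ is non-empty, normalized so that $\infty$ lies in the limit set $L_\Gamma=\mathbb P^1\setminus U_\Gamma$ (hence $U_\Gamma\subset\mathbb C$). Let $\rho\,|dz|^2$ be a smooth $\Gamma$-invariant conformal metric on $U_\Gamma$: $\rho>0$ and $\rho(\gamma z)\,|\gamma'(z)|^2=\rho(z)$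 for $\gamma\in\Gamma$. Write $d^c=\partial-\bar\partial$ and $\pi_1(\alpha)=\frac12(\alpha-\bar\alpha)$. For $\gamma\in\Gamma$ represented by $\begin{pmatrix}a&b\\c&d\end{pmatrix}$ put $c_\gamma=\det\gamma/c^2$ and $$\kappa_\gamma=\log|c_\gamma|\;\pi_1\,d\log\gamma'$$ ($\kappa_\gamma=0$ if $c=0$, since then $d\log\gamma'=0$). For $\gamma_1,\gamma_2\in\Gamma$ put $z_2=\gamma_2^{-1}(\infty)$, $z_{12}=(\gamma_1\gamma_2)^{-1}(\infty)$ and $T_{12}(z)=[z:z_{12}:z_2:\infty]=\frac{z-z_{12}}{z-z_2}$. Define $$\omega^0=\tfrac12\,\partial\log\rho\wedge\bar\partial\log\rho,\qquad \omega^1_\gamma=\bigl(\tfrac12\log\rho+\tfrac12\log\rho\circ\gamma\bigr)\,d^c\log|\gamma'|+\kappa_\gamma,\qquad \hat\omega^2_{\gamma_1,\gamma_2}=-4\,\mathcal L_2\circ T_{12}.$$ Consider the double complex whose component of bidegree $(p,q)$ consists of the $q$-cochains on $\Gamma$ with values in $p$-forms on $U_\Gamma$, $\Gamma$ acting on the right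 by pull-back, with group coboundary $$(\delta c)_{\gamma_1,\dots,\gamma_{n}}=c_{\gamma_2,\dots,\gamma_{n}}+\sum_{i=1}^{n-1}(-1)^i c_{\gamma_1,\dots,\gamma_i\gamma_{i+1},\dots,\gamma_{n}}+(-1)^{n}\gamma_{n}^*\,c_{\gamma_1,\dots,\gamma_{n-1}}$$ and total differential $D=d+(-1)^p\delta$. **Lemma.** The components of $\omega^0+\omega^1+\hat\omega^2$ are smooth, purely imaginary forms on $U_\Gamma$, and $$D(\omega^0+\omega^1+\hat\omega^2)_{\gamma_1,\gamma_2,\gamma_3}=-4\,\mathcal L_2\bigl([\infty:\gamma_1(\infty):\gamma_1\gamma_2(\infty):\gamma_1\gamma_2\gamma_3(\infty)]\bigr);$$ that is, all components of the left-hand side vanish except the one of bidegree $(0,3)$, whose value at $(\gamma_1,\gamma_2,\gamma_3)$ is the displayed constant function on $U_\Gamma$. Moreover the function $$(g_1,g_2,g_3)\longmapsto \mathcal L_2\bigl([\infty:g_1(\infty):g_1g_2(\infty):g_1g_2g_3(\infty)]\bigr)$$ is a $3$-cocycle on the whole group $\mathrm{PSL}_2(\mathbb C)$ with values in the trivial module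 $\sqrt{-1}\,\mathbb R$. Thus the obstruction is $-4$ times the restriction to $\Gamma$ of this dilogarithmic regulator cocycle. -/

import Mathlib

open scoped MatrixGroups
open OnePoint

noncomputable section

namespace KleinianLiouville

/-! ### The Bloch–Wigner dilogarithm -/

/-- Euler's dilogarithm `Li₂(z) = -∫₀ᶻ log (1 - t) dt / t`, integrated along the segment from `0`
to `z`, with the principal branch of the logarithm. -/
def dilog (z : ℂ) : ℂ :=
  -∫ t in (0 : ℝ)..1, Complex.log (1 - (t : ℂ) * z) / (t : ℂ)

/-- The Bloch–Wigner dilogarithm `D₂(z) = arg (1 - z) log |z| + Im Li₂(z)` on `ℂ`. The jumps of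
`arg (1 - z)` and of `Li₂` along `(1, ∞)` cancel, so the principal branches give the single-valued
continuous function; it vanishes at `0` and `1`. -/
def blochWignerC (z : ℂ) : ℝ :=
  Complex.arg (1 - z) * Real.log ‖z‖ + (dilog z).im

/-- The Bloch–Wigner dilogarithm on `ℙ¹(ℂ) = ℂ ∪ {∞}`, with its continuous extension
`D₂(∞) = 0`. -/
def blochWigner : OnePoint ℂ → ℝ
  | ∞ => 0
  | (z : ℂ) => blochWignerC z

/-- `𝓛₂ = √-1 · D₂`. -/
def L2 (w : OnePoint ℂ) : ℂ := Complex.I * (blochWigner w : ℂ)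

/-! ### The projective line, the cross-ratio and the action of `PSL₂(ℂ)` -/

/-- Homogeneous coordinates of a point of `ℙ¹(ℂ)`. -/
def homog : OnePoint ℂ → ℂ × ℂ
  | ∞ => (1, 0)
  | (z : ℂ) => (z, 1)

/-- The determinant of the homogeneous coordinates; equal to `a - b` for finite `a`, `b`. -/
def bracket (a b : OnePoint ℂ) : ℂ :=
  (homog a).1 * (homog b).2 - (homog b).1 * (homog a).2

/-- The cross-ratio `[a : b : c : d] = (a - b) (c - d) / ((a - c) (b - d))` in `ℙ¹(ℂ)`, so that
`[z : b : c : ∞] = (z - b) / (z - c)`. If three of the points coincide it is undefined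
and set to `∞`, a point where `D₂` vanishes. -/
def crossRatio (a b c d : OnePoint ℂ) : OnePoint ℂ :=
  if bracket a c * bracket b d = 0 then ∞
  else ((bracket a b * bracket c d / (bracket a c * bracket b d) : ℂ) : OnePoint ℂ)

/-- The action of `SL₂(ℂ)` on `ℙ¹(ℂ)` by fractional linear transformations. -/
def slAction : SL(2, ℂ) →* Equiv.Perm (OnePoint ℂ) :=
  (MulAction.toPermHom (GL (Fin 2) ℂ) (OnePoint ℂ)).comp Matrix.SpecialLinearGroup.toGL

theorem center_eq_one_or_neg_one {A : SL(2, ℂ)} (hA : A ∈ Subgroup.center SL(2, ℂ)) :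
    A = 1 ∨ A = -1 := by
  obtain ⟨r, hr, hA⟩ := Matrix.SpecialLinearGroup.mem_center_iff.1 hA
  have h2 : r = 1 ∨ r = -1 := sq_eq_one_iff.1 (by simpa using hr)
  rcases h2 with rfl | rfl
  · left
    ext i j
    simp [← hA]
  · right
    ext i j
    simp [← hA, Matrix.diagonal_apply, Matrix.one_apply]
    split_ifs <;> simp

theorem center_le_ker_slAction : Subgroup.center SL(2, ℂ) ≤ slAction.ker := by
  intro A hA
  rw [MonoidHom.mem_ker]
  rcases center_eq_one_or_neg_one hA with rfl | rfl
  · simp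
  · ext x
    simp only [slAction, MonoidHom.comp_apply, MulAction.toPermHom_apply, MulAction.toPerm_apply,
      Equiv.Perm.coe_one, id_eq]
    cases x with
    | infty => simp [smul_infty_eq_ite]
    | coe k => simp [smul_some_eq_ite]

/-- The action of `PSL₂(ℂ)` on `ℙ¹(ℂ)` by fractional linear transformations. -/
instance pslAction : MulAction PSL(2, ℂ) (OnePoint ℂ) :=
  MulAction.compHom (OnePoint ℂ)
    (QuotientGroup.lift (Subgroup.center SL(2, ℂ)) slAction center_le_ker_slAction)

/-- The quantity `c_γ = det γ / c²` for `γ = (a b; c d)`; it is independent of the choice of the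
matrix. It is used below only multiplied by `d log γ'`, which vanishes when `c = 0`. -/
def cCoeff : PSL(2, ℂ) → ℂ :=
  Quotient.lift (fun A : SL(2, ℂ) => 1 / (A 1 0) ^ 2) (by
    intro A B h
    have h' : A⁻¹ * B ∈ Subgroup.center SL(2, ℂ) := QuotientGroup.leftRel_apply.1 h
    rcases center_eq_one_or_neg_one h' with h1 | h1
    · have : B = A := by rw [← mul_inv_cancel_left A B, h1, mul_one]
      rw [this]
    · have : B = -A := by rw [← mul_inv_cancel_left A B, h1, mul_neg, mul_one]
      simp [this])

/-- The fractional linear transformation `z ↦ γ(z)` in the affine coordinate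
(with a dummy value at the pole of `γ`). -/
def mob (γ : PSL(2, ℂ)) (z : ℂ) : ℂ := (γ • (z : OnePoint ℂ)).elim 0 id

/-- The region of discontinuity `U_Γ` of `Γ`: the points of `ℙ¹(ℂ)` with a neighbourhood that
meets only finitely many of its translates. -/
def discontinuityRegion (Γ : Subgroup PSL(2, ℂ)) : Set (OnePoint ℂ) :=
  {x | ∃ V : Set (OnePoint ℂ), IsOpen V ∧ x ∈ V ∧
    {γ : Γ | (((fun y => (γ : PSL(2, ℂ)) • y) '' V) ∩ V).Nonempty}.Finite}

/-- The limit set `L_Γ = ℙ¹(ℂ) ∖ U_Γ`. -/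
def limitSet (Γ : Subgroup PSL(2, ℂ)) : Set (OnePoint ℂ) := (discontinuityRegion Γ)ᶜ

/-- `U_Γ` in the affine coordinate; this is all of `U_Γ` when `∞ ∈ L_Γ`. -/
def affineRegion (Γ : Subgroup PSL(2, ℂ)) : Set ℂ :=
  {z | (z : OnePoint ℂ) ∈ discontinuityRegion Γ}

/-! ### Differential forms on planar domains -/

/-- Complex-valued `p`-forms in the real variable `z ∈ ℂ ≅ ℝ²`. -/
abbrev Form (p : ℕ) := ℂ → ℂ [⋀^Fin p]→L[ℝ] ℂ

/-- A function as a `0`-form. -/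
def form0 (f : ℂ → ℂ) : Form 0 := fun z =>
  ContinuousAlternatingMap.constOfIsEmpty ℝ ℂ (Fin 0) (f z)

/-- A field of real-linear functionals as a `1`-form. -/
def form1 (α : ℂ → ℂ →L[ℝ] ℂ) : Form 1 := fun z =>
  ContinuousAlternatingMap.ofSubsingleton ℝ ℂ ℂ (0 : Fin 1) (α z)

/-- The wedge product `(α ∧ β)(v, w) = α(v) β(w) - α(w) β(v)` of two `1`-forms. -/
def wedge (α β : ℂ → ℂ →L[ℝ] ℂ) : Form 2 := fun z =>
  ContinuousMultilinearMap.alternatization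
    ((ContinuousMultilinearMap.mkPiAlgebra ℝ (Fin 2) ℂ).compContinuousLinearMap ![α z, β z])

/-- `∂f`, the complex-linear part of the differential of `f`. -/
def del (f : ℂ → ℂ) (z : ℂ) : ℂ →L[ℝ] ℂ :=
  (1 / 2 : ℂ) • (fderiv ℝ f z -
    Complex.I • (fderiv ℝ f z).comp (Complex.I • ContinuousLinearMap.id ℝ ℂ))

/-- `∂̄f`, the complex-antilinear part of the differential of `f`. -/
def delbar (f : ℂ → ℂ) (z : ℂ) : ℂ →L[ℝ] ℂ :=
  (1 / 2 : ℂ) • (fderiv ℝ f z +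
    Complex.I • (fderiv ℝ f z).comp (Complex.I • ContinuousLinearMap.id ℝ ℂ))

/-- `d^c f = ∂f - ∂̄f`. -/
def dc (f : ℂ → ℂ) (z : ℂ) : ℂ →L[ℝ] ℂ := del f z - delbar f z

/-- The logarithmic differential `d log f = f'(z) dz / f(z)` of a holomorphic function. -/
def dlog (f : ℂ → ℂ) (z : ℂ) : ℂ →L[ℝ] ℂ :=
  (deriv f z / f z) • ContinuousLinearMap.id ℝ ℂ

/-- `π₁(α) = (α - ᾱ) / 2` on `1`-forms. -/
def pi1 (α : ℂ → ℂ →L[ℝ] ℂ) (z : ℂ) : ℂ →L[ℝ] ℂ :=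
  (1 / 2 : ℂ) • (α z - (Complex.conjCLE : ℂ →L[ℝ] ℂ).comp (α z))

/-- The pull-back `γ^* ω`. -/
def pullback {p : ℕ} (γ : PSL(2, ℂ)) (ω : Form p) : Form p := fun z =>
  (ω (mob γ z)).compContinuousLinearMap (fderiv ℝ (mob γ) z)

/-! ### Group cochains and the total complex -/

/-- The coboundary of inhomogeneous group cochains with values in a right module, the right action
of `g` being `act g`:
`(δc)(g₁,…,gₙ₊₁) = c(g₂,…,gₙ₊₁) + ∑ᵢ (-1)ⁱ c(…,gᵢgᵢ₊₁,…) + (-1)ⁿ⁺¹ c(g₁,…,gₙ) · gₙ₊₁`. -/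
def coboundary {G A : Type*} [Group G] [AddCommGroup A] (act : G → A → A) {n : ℕ}
    (c : (Fin n → G) → A) : (Fin (n + 1) → G) → A := fun g =>
  c (Fin.tail g)
    + ∑ i : Fin n, (-1 : ℤ) ^ ((i : ℕ) + 1) • c (Fin.contractNth i.castSucc (· * ·) g)
    + (-1 : ℤ) ^ (n + 1) • act (g (Fin.last n)) (c (Fin.init g))

/-- Group cochains on `Γ` of degree `q` with values in `p`-forms. -/
abbrev Cochain (Γ : Subgroup PSL(2, ℂ)) (p q : ℕ) := (Fin q → Γ) → Form p

/-- The group (Čech) coboundary, `Γ` acting on forms by pull-back. -/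
def cech {Γ : Subgroup PSL(2, ℂ)} {p q : ℕ} (c : Cochain Γ p q) : Cochain Γ p (q + 1) :=
  coboundary (fun (γ : Γ) ω => pullback (γ : PSL(2, ℂ)) ω) c

/-- The de Rham differential on cochains. -/
def deRham {Γ : Subgroup PSL(2, ℂ)} {p q : ℕ} (c : Cochain Γ p q) : Cochain Γ (p + 1) q :=
  fun g => extDeriv (c g)

/-- Elements of the double complex: a component in each bidegree `(p, q)`, with `p` the degree of
forms and `q` the group degree. -/
abbrev TotalCochain (Γ : Subgroup PSL(2, ℂ)) := ∀ p q : ℕ, Cochain Γ p q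

/-- The total differential, `D = d + (-1)^p δ` on the component of bidegree `(p, q)`. -/
def totalD {Γ : Subgroup PSL(2, ℂ)} (c : TotalCochain Γ) : TotalCochain Γ
  | 0, 0 => 0
  | p + 1, 0 => deRham (c p 0)
  | 0, q + 1 => cech (c 0 q)
  | p + 1, q + 1 => deRham (c p (q + 1)) + (-1 : ℤ) ^ (p + 1) • cech (c (p + 1) q)

/-- Two elements of the double complex agree as families of forms on `U`. -/
def AgreeOn {Γ : Subgroup PSL(2, ℂ)} (U : Set ℂ) (c c' : TotalCochain Γ) : Prop :=
  ∀ (p q : ℕ) (g : Fin q → Γ), Set.EqOn (c p q g) (c' p q g) U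

/-- All components are smooth, purely imaginary forms on `U`. -/
def IsSmoothImaginaryOn {Γ : Subgroup PSL(2, ℂ)} (U : Set ℂ) (c : TotalCochain Γ) : Prop :=
  ∀ (p q : ℕ) (g : Fin q → Γ), ContDiffOn ℝ ((⊤ : ℕ∞) : WithTop ℕ∞) (c p q g) U ∧
    ∀ z ∈ U, ∀ v : Fin p → ℂ, (c p q g z v).re = 0

/-! ### The Liouville cochain of a Kleinian cover -/

/-- `ρ |dz|²` is a smooth conformal metric on `U_Γ` (given in the affine coordinate) invariant
under `Γ`, that is, a conformal metric on `U_Γ / Γ`. -/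
structure IsConformalMetric (Γ : Subgroup PSL(2, ℂ)) (ρ : ℂ → ℝ) : Prop where
  smooth : ContDiffOn ℝ ((⊤ : ℕ∞) : WithTop ℕ∞) ρ (affineRegion Γ)
  pos : ∀ z ∈ affineRegion Γ, 0 < ρ z
  automorphic : ∀ γ ∈ Γ, ∀ z ∈ affineRegion Γ, ρ (mob γ z) * ‖deriv (mob γ) z‖ ^ 2 = ρ z

/-- `ω⁰ = ½ ∂ log ρ ∧ ∂̄ log ρ`. -/
def omega0 (ρ : ℂ → ℝ) : Form 2 := fun z =>
  (1 / 2 : ℂ) • wedge (del fun w => (Real.log (ρ w) : ℂ)) (delbar fun w => (Real.log (ρ w) : ℂ)) z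

/-- `κ_γ = log |c_γ| π₁ (d log γ')`. -/
def kappa (γ : PSL(2, ℂ)) : Form 1 :=
  form1 fun z => (Real.log ‖cCoeff γ‖ : ℂ) • pi1 (dlog (deriv (mob γ))) z

/-- `ω¹_γ = (½ log ρ + ½ log ρ∘γ) d^c log |γ'| + κ_γ`. -/
def omega1 (ρ : ℂ → ℝ) (γ : PSL(2, ℂ)) : Form 1 :=
  form1 (fun z =>
    ((1 / 2 * Real.log (ρ z) + 1 / 2 * Real.log (ρ (mob γ z)) : ℝ) : ℂ) •
      dc (fun w => (Real.log ‖deriv (mob γ) w‖ : ℂ)) z) + kappa γ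

/-- `T₁₂(z) = [z : z₁₂ : z₂ : ∞]` with `z₂ = γ₂⁻¹(∞)`, `z₁₂ = (γ₁γ₂)⁻¹(∞)`. -/
def T (γ₁ γ₂ : PSL(2, ℂ)) (z : ℂ) : OnePoint ℂ :=
  crossRatio z ((γ₁ * γ₂)⁻¹ • (∞ : OnePoint ℂ)) (γ₂⁻¹ • (∞ : OnePoint ℂ)) ∞

/-- `ω̂²_{γ₁,γ₂} = -4 𝓛₂ ∘ T₁₂`. -/
def omega2 (γ₁ γ₂ : PSL(2, ℂ)) : Form 0 := form0 fun z => -4 * L2 (T γ₁ γ₂ z)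

/-- The cochain `ω⁰ + ω¹ + ω̂²`, of total degree two. -/
def liouvilleCochain (Γ : Subgroup PSL(2, ℂ)) (ρ : ℂ → ℝ) : TotalCochain Γ
  | 2, 0 => fun _ => omega0 ρ
  | 1, 1 => fun g => omega1 ρ (g 0)
  | 0, 2 => fun g => omega2 (g 0) (g 1)
  | _, _ => 0

/-- The dilogarithmic regulator cochain
`(γ₁, γ₂, γ₃) ↦ 𝓛₂([∞ : γ₁(∞) : γ₁γ₂(∞) : γ₁γ₂γ₃(∞)])` on `PSL₂(ℂ)`. -/
def regulator (g : Fin 3 → PSL(2, ℂ)) : ℂ :=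
  L2 (crossRatio ∞ (g 0 • (∞ : OnePoint ℂ)) ((g 0 * g 1) • (∞ : OnePoint ℂ))
    ((g 0 * g 1 * g 2) • (∞ : OnePoint ℂ)))

/-- The element of the double complex concentrated in bidegree `(0, 3)` whose value at
`(γ₁, γ₂, γ₃)` is the constant function `a(γ₁, γ₂, γ₃)`. -/
def constantThreeCochain (Γ : Subgroup PSL(2, ℂ)) (a : (Fin 3 → Γ) → ℂ) : TotalCochain Γ
  | 0, 3 => fun g => form0 fun _ => a g
  | _, _ => 0

end KleinianLiouville

end

noncomputable section

namespace KleinianLiouville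

open Filter Topology Set MeasureTheory

/-! Everything about $D_2$ follows from its differential $\log|z|\,d\arg(1-z)-\log|1-z|\,d\arg z$ on
$\mathbb C\setminus\{0,1\}$ (`hasFDerivAt_blochWignerC`). Each functional equation says that a
combination of such differentials vanishes on a connected open set, and the constant is found at a
point or as a limit. In this way $D_2$ of the cross-ratio becomes an alternating,
$\mathrm{PSL}_2(\mathbb C)$-invariant function of four points satisfying the five-term relation
`fiveTerm_eq_zero`. Alternation disposes of all coincidences, so no genericity is needed. The
cocycle property is the five-term relation at the orbit points $\infty, g_1\infty,
g_1g_2\infty,\dots$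

For the double complex, $\infty\in L_\Gamma$ ensures that no element of $\Gamma$ has its pole in
$U_\Gamma$. Write $h=\gamma''/\gamma'$ and $d\log\rho=\operatorname{Re}(q\,dz)$. Automorphy gives
$\log\rho\circ\gamma=\log\rho-2\log|\gamma'|$, so pull-back replaces $q$ by $q-2h$ and
$\omega^1_\gamma$ becomes $i(\log\rho-\log|\gamma'|+\log|c_\gamma|)\operatorname{Im}(h\,dz)$
(`omega1_eqOn`). Three identities remain, since 3-forms on the plane vanish. `extDeriv_omega1`: $h$
is holomorphic, so only the coefficient is differentiated, and the result matches $|q-2h|^2-|q|^2$.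
`extDeriv_omega2`: in $\delta\omega^1$ the metric cancels, and the remaining logarithms of $|cz+d|$
and $|c|$ are those in the differential of $D_2\circ T_{12}$. The term $\kappa_\gamma$ supplies the
$\log|c|$, and the 4 is the product of the factors $-2$ in $\log|\gamma'|=-2\log|cz+d|$ and
$h=-2c/(cz+d)$. `coboundary_omega2`: this is the five-term relation for $z$, three poles and
$\infty$; the face omitting $z$ is a translate of the regulator. -/

/-! ### The differential of the dilogarithm off the branch cut. -/

theorem one_sub_mul_mem_slitPlane {z : ℂ} (hz : 1 - z ∈ Complex.slitPlane) {t : ℝ}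
    (ht : t ∈ Icc (0 : ℝ) 1) : 1 - (t : ℂ) * z ∈ Complex.slitPlane := by
  have := (Complex.starConvex_one_slitPlane) hz (sub_nonneg.2 ht.2) ht.1 (by ring)
  convert this using 1
  simp only [Complex.real_smul]
  push_cast
  ring

theorem hasDerivAt_log_one_sub_mul {z : ℂ} {t : ℝ} (h : 1 - (t : ℂ) * z ∈ Complex.slitPlane) :
    HasDerivAt (fun s : ℝ => Complex.log (1 - (s : ℂ) * z)) (-z / (1 - t * z)) t := by
  have h1 : HasDerivAt (fun s : ℝ => 1 - (s : ℂ) * z) (-z) t := by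
    simpa using ((Complex.ofRealCLM.hasDerivAt (x := t)).mul_const z).const_sub 1
  exact h1.clog_real h

theorem intervalIntegrable_log_div (z : ℂ) {a : ℝ} (ha : 0 ≤ a)
    (h : ∀ t ∈ Icc 0 a, 1 - (t : ℂ) * z ∈ Complex.slitPlane) :
    IntervalIntegrable (fun t : ℝ => Complex.log (1 - (t : ℂ) * z) / (t : ℂ)) volume 0 a := by
  -- The singularity at $t=0$ is removable: off it the integrand is the slope at $0$ of
  -- $\log(1-tz)$, and `dslope` fills in the derivative.
  have hc : ContinuousOn (dslope (fun t : ℝ => Complex.log (1 - (t : ℂ) * z)) 0) (uIcc 0 a) := by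
    rw [uIcc_of_le ha]
    intro t ht
    by_cases h0 : t = 0
    · subst h0
      exact (continuousAt_dslope_same.2
        (hasDerivAt_log_one_sub_mul (h 0 ht)).differentiableAt).continuousWithinAt
    · exact ((continuousAt_dslope_of_ne h0).2
        (hasDerivAt_log_one_sub_mul (h t ht)).continuousAt).continuousWithinAt
  refine hc.intervalIntegrable.congr_ae ?_
  refine (ae_restrict_of_ae ?_)
  filter_upwards [compl_mem_ae_iff.2 (measure_singleton (0 : ℝ))] with t ht
  rw [dslope_of_ne _ ht, slope_def_module]
  simp [div_eq_inv_mul]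

/-- Differentiation under the integral sign cancels the $1/t$. The derivative is left as an integral
so that the formula also covers $z=0$, where continuity is needed later. -/
theorem hasDerivAt_dilog_integral {z : ℂ} (hz : 1 - z ∈ Complex.slitPlane) :
    HasDerivAt dilog (∫ t in (0 : ℝ)..1, 1 / (1 - (t : ℂ) * z)) z := by
  have hopen : IsOpen {w : ℂ | 1 - w ∈ Complex.slitPlane} :=
    Complex.isOpen_slitPlane.preimage (by fun_prop)
  obtain ⟨r, hr, hball⟩ := Metric.nhds_basis_closedBall.mem_iff.1 (hopen.mem_nhds hz)
  have hne : ∀ p ∈ Icc (0 : ℝ) 1 ×ˢ Metric.closedBall z r, 1 - (p.1 : ℂ) * p.2 ≠ 0 :=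
    fun p hp => Complex.slitPlane_ne_zero (one_sub_mul_mem_slitPlane (hball hp.2) hp.1)
  obtain ⟨C, hC⟩ := (isCompact_Icc.prod (isCompact_closedBall z r)).exists_bound_of_continuousOn
    (f := fun p : ℝ × ℂ => -1 / (1 - (p.1 : ℂ) * p.2))
    (ContinuousOn.div (by fun_prop) (by fun_prop) hne)
  have key := intervalIntegral.hasDerivAt_integral_of_dominated_loc_of_deriv_le (μ := volume)
    (a := 0) (b := 1) (F := fun (w : ℂ) (t : ℝ) => Complex.log (1 - (t : ℂ) * w) / (t : ℂ))
    (F' := fun (w : ℂ) (t : ℝ) => -1 / (1 - (t : ℂ) * w)) (x₀ := z) (s := Metric.closedBall z r)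
    (bound := fun _ => C) (Metric.closedBall_mem_nhds z hr) ?_ ?_ ?_ ?_ ?_ ?_
  · have h2 := key.2.neg
    rw [← intervalIntegral.integral_neg] at h2
    refine (h2.congr_deriv ?_).congr_of_eventuallyEq ?_
    · exact intervalIntegral.integral_congr fun t _ => by simp [neg_div]
    · exact Eventually.of_forall fun w => rfl
  · refine Eventually.of_forall fun w => Measurable.aestronglyMeasurable ?_
    exact (Complex.measurable_log.comp (by fun_prop)).div (by fun_prop)
  · exact intervalIntegrable_log_div z zero_le_one fun t ht => one_sub_mul_mem_slitPlane hz ht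
  · exact Measurable.aestronglyMeasurable (by fun_prop)
  · refine Eventually.of_forall fun t ht w hw => ?_
    rw [uIoc_of_le zero_le_one] at ht
    exact hC (t, w) ⟨Ioc_subset_Icc_self ht, hw⟩
  · simp
  · refine Eventually.of_forall fun t ht w hw => ?_
    rw [uIoc_of_le zero_le_one] at ht
    have hs := one_sub_mul_mem_slitPlane (hball hw) (Ioc_subset_Icc_self ht)
    have h1 : HasDerivAt (fun x : ℂ => 1 - (t : ℂ) * x) (-t) w := by
      simpa using ((hasDerivAt_id w).const_mul (t : ℂ)).const_sub 1
    have ht0 : (t : ℂ) ≠ 0 := by exact_mod_cast ht.1.ne'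
    refine ((h1.clog hs).div_const (t : ℂ)).congr_deriv ?_
    have := Complex.slitPlane_ne_zero hs
    field_simp

theorem mul_integral_one_div {z : ℂ} (hz : 1 - z ∈ Complex.slitPlane) :
    z * ∫ t in (0 : ℝ)..1, 1 / (1 - (t : ℂ) * z) = -Complex.log (1 - z) := by
  have h := intervalIntegral.integral_eq_sub_of_hasDerivAt (a := 0) (b := 1)
    (f := fun s : ℝ => Complex.log (1 - (s : ℂ) * z)) (f' := fun t : ℝ => -z / (1 - t * z))
    (fun t ht => hasDerivAt_log_one_sub_mul (one_sub_mul_mem_slitPlane hz (by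
      rwa [uIcc_of_le zero_le_one] at ht))) ?_
  · rw [← intervalIntegral.integral_const_mul]
    simp only [Complex.ofReal_one, one_mul, Complex.ofReal_zero, zero_mul, sub_zero,
      Complex.log_one] at h
    rw [← h, ← intervalIntegral.integral_neg]
    exact intervalIntegral.integral_congr fun t _ => by simp [div_eq_mul_inv]
  · refine ContinuousOn.intervalIntegrable (ContinuousOn.div (by fun_prop) (by fun_prop) ?_)
    intro t ht
    rw [uIcc_of_le zero_le_one] at ht
    exact Complex.slitPlane_ne_zero (one_sub_mul_mem_slitPlane hz ht)

theorem hasDerivAt_dilog {z : ℂ} (hz : 1 - z ∈ Complex.slitPlane) (h0 : z ≠ 0) :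
    HasDerivAt dilog (-Complex.log (1 - z) / z) z := by
  refine (hasDerivAt_dilog_integral hz).congr_deriv ?_
  rw [← mul_integral_one_div hz, mul_div_cancel_left₀ _ h0]

/-- The real-linear functional `v ↦ Im (a v)`. -/
def imMul (a : ℂ) : ℂ →L[ℝ] ℝ := Complex.imCLM.comp (a • ContinuousLinearMap.id ℝ ℂ)

@[simp]
theorem imMul_apply (a v : ℂ) : imMul a v = (a * v).im := rfl

/-- The differential `log |z| d arg (1 - z) - log |1 - z| d arg z` of the Bloch–Wigner
dilogarithm. -/
def blochWignerDeriv (z : ℂ) : ℂ →L[ℝ] ℝ :=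
  Real.log ‖z‖ • imMul (-1 / (1 - z)) - Real.log ‖1 - z‖ • imMul (1 / z)

theorem hasFDerivAt_im_of_hasDerivAt {f : ℂ → ℂ} {f' z : ℂ} (h : HasDerivAt f f' z) :
    HasFDerivAt (fun w => (f w).im) (imMul f') z := by
  refine (Complex.imCLM.hasFDerivAt.comp z (h.hasFDerivAt.restrictScalars ℝ)).congr_fderiv ?_
  ext
  all_goals simp [mul_comm]

theorem hasFDerivAt_re_of_hasDerivAt {f : ℂ → ℂ} {f' z : ℂ} (h : HasDerivAt f f' z) :
    HasFDerivAt (fun w => (f w).re) (Complex.reCLM.comp (f' • ContinuousLinearMap.id ℝ ℂ)) z := by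
  refine (Complex.reCLM.hasFDerivAt.comp z (h.hasFDerivAt.restrictScalars ℝ)).congr_fderiv ?_
  ext
  all_goals simp [mul_comm]

theorem hasFDerivAt_log_norm {f : ℂ → ℂ} {f' z : ℂ} (h : HasDerivAt f f' z) (h0 : f z ≠ 0) :
    HasFDerivAt (fun w => Real.log ‖f w‖)
      (Complex.reCLM.comp ((f' / f z) • ContinuousLinearMap.id ℝ ℂ)) z := by
  -- Dividing by the constant `f z` moves the value to $1$, away from the cut of the logarithm, and
  -- changes $\log|f|$ only by a constant.
  have h1 : HasDerivAt (fun w => f w / f z) (f' / f z) z := h.div_const _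
  have h2 := (h1.clog (by rw [div_self h0]; exact Complex.one_mem_slitPlane))
  rw [div_self h0, div_one] at h2
  have h3 := (hasFDerivAt_re_of_hasDerivAt h2).add_const (Real.log ‖f z‖)
  refine h3.congr_of_eventuallyEq ?_
  filter_upwards [h.continuousAt.eventually_ne h0] with w hw
  rw [Complex.log_re, norm_div, Real.log_div (by simpa using hw) (by simpa using h0)]
  ring

/-- The product rule produces $\arg(1-z)\,d\log|z|$, which cancels the same term in
$\operatorname{Im}(-\log(1-z)\,dz/z)$. -/
theorem hasFDerivAt_blochWignerC_of_mem_slitPlane {z : ℂ} (hz : 1 - z ∈ Complex.slitPlane)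
    (h0 : z ≠ 0) : HasFDerivAt blochWignerC (blochWignerDeriv z) z := by
  have h1 := hasFDerivAt_im_of_hasDerivAt (((hasDerivAt_id z).const_sub 1).clog hz)
  have h2 := hasFDerivAt_log_norm (hasDerivAt_id z) h0
  have h3 := hasFDerivAt_im_of_hasDerivAt (hasDerivAt_dilog hz h0)
  have h4 : blochWignerC = (((fun w => (Complex.log (1 - id w)).im) * fun w => Real.log ‖id w‖) +
      fun w => (dilog w).im) := by
    funext w
    simp [blochWignerC, Complex.log_im]
  rw [h4]
  refine ((h1.mul h2).add h3).congr_fderiv ?_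
  ext1 v
  simp only [blochWignerDeriv, id, add_apply, sub_apply,
    smul_apply, imMul_apply, smul_eq_mul, ContinuousLinearMap.comp_apply,
    ContinuousLinearMap.id_apply, Complex.reCLM_apply]
  rw [show -Complex.log (1 - z) / z = -(Complex.log (1 - z) * (1 / z)) by ring]
  simp only [Complex.log_im, Complex.log_re, Complex.mul_im, Complex.mul_re, Complex.neg_im,
    Complex.neg_re]
  ring

/-! ### Vanishing on the real axis. -/

theorem dilog_ofReal_im_of_le_one {x : ℝ} (hx : x ≤ 1) : (dilog x).im = 0 := by
  have h : ∫ t in (0 : ℝ)..1, Complex.log (1 - (t : ℂ) * x) / (t : ℂ) =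
      ∫ t in (0 : ℝ)..1, ((Real.log (1 - t * x) / t : ℝ) : ℂ) := by
    refine intervalIntegral.integral_congr fun t ht => ?_
    rw [uIcc_of_le zero_le_one] at ht
    have h0 : 0 ≤ 1 - t * x := by nlinarith [ht.1, ht.2]
    simp only [Complex.ofReal_div, Complex.ofReal_log h0]
    push_cast
    rfl
  rw [dilog, h, intervalIntegral.integral_ofReal]
  simp

/-- The real part is the log-norm of an analytic function and the imaginary part is bounded by
$\pi$, so integrability persists across the branch point $t=1/x$. -/
theorem intervalIntegrable_log_one_sub_mul (x a b : ℝ) :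
    IntervalIntegrable (fun t : ℝ => Complex.log (1 - (t : ℂ) * x)) volume a b := by
  have h1 : IntervalIntegrable (fun t : ℝ => ((Real.log ‖1 - t * x‖ : ℝ) : ℂ)) volume a b := by
    have : IntervalIntegrable (fun t : ℝ => Real.log ‖1 - t * x‖) volume a b :=
      MeromorphicOn.intervalIntegrable_log_norm fun t _ =>
        AnalyticAt.meromorphicAt (by fun_prop)
    exact ⟨this.1.ofReal, this.2.ofReal⟩
  have h2 : IntervalIntegrable
      (fun t : ℝ => ((Complex.arg (1 - (t : ℂ) * x) : ℝ) : ℂ) * Complex.I) volume a b := by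
    refine (intervalIntegrable_const (c := Real.pi)).mono_fun' ?_ ?_
    · refine Measurable.aestronglyMeasurable ?_
      exact (Complex.measurable_ofReal.comp (Complex.measurable_arg.comp (by fun_prop))).mul_const _
    · refine Eventually.of_forall fun t => ?_
      simpa using Complex.abs_arg_le_pi _
  refine (h1.add h2).congr fun t _ => ?_
  have : ‖1 - t * x‖ = ‖1 - (t : ℂ) * x‖ := by
    rw [← Complex.norm_real]
    push_cast
    rfl
  simp only [Complex.log, this]

theorem intervalIntegrable_log_div_ofReal {x : ℝ} (hx : 1 < x) :
    IntervalIntegrable (fun t : ℝ => Complex.log (1 - (t : ℂ) * x) / (t : ℂ)) volume 0 1 := by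
  have hx0 : 0 < x := by linarith
  have ha : 0 < 1 / (2 * x) := by positivity
  have h1 : (1 / (2 * x)) ≤ 1 := by rw [div_le_one (by positivity)]; linarith
  -- Splitting at $1/(2x)$ separates the removable singularity at $0$ from the branch point $1/x$;
  -- to the right of it $1/t$ is continuous.
  refine (intervalIntegrable_log_div (x : ℂ) ha.le fun t ht => ?_).trans (b := 1 / (2 * x)) ?_
  · have h2 : t * x ≤ 1 / 2 := by
      have := mul_le_mul_of_nonneg_right ht.2 hx0.le
      rwa [show 1 / (2 * x) * x = 1 / 2 by field_simp] at this
    left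
    have : (1 - (t : ℂ) * x).re = 1 - t * x := by simp
    rw [this]
    linarith
  · simp only [div_eq_mul_inv _ (Complex.ofReal _)]
    refine (intervalIntegrable_log_one_sub_mul x _ _).mul_continuousOn ?_
    rw [uIcc_of_le h1]
    refine ContinuousOn.inv₀ (by fun_prop) fun t ht => ?_
    exact_mod_cast (ha.trans_le ht.1).ne'

/-- The argument of $1-tx$ is $0$ up to $t=1/x$ and $\pi$ beyond, which leaves $-\pi\int_{1/x}^1
dt/t$. -/
theorem dilog_ofReal_im_of_one_lt {x : ℝ} (hx : 1 < x) :
    (dilog x).im = -(Real.pi * Real.log x) := by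
  have hx0 : 0 < x := by linarith
  have hint := intervalIntegrable_log_div_ofReal hx
  have h1 : (∫ t in (0 : ℝ)..1, Complex.log (1 - (t : ℂ) * x) / (t : ℂ)).im =
      ∫ t in (0 : ℝ)..1, (Complex.log (1 - (t : ℂ) * x) / (t : ℂ)).im :=
    (Complex.imCLM.intervalIntegral_comp_comm hint).symm
  have him : ∀ t : ℝ, (Complex.log (1 - (t : ℂ) * x) / (t : ℂ)).im =
      Complex.arg ((1 - t * x : ℝ) : ℂ) / t := fun t => by
    rw [Complex.div_ofReal_im, Complex.log_im]
    push_cast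
    rfl
  have hint' : IntervalIntegrable (fun t : ℝ => (Complex.log (1 - (t : ℂ) * x) / (t : ℂ)).im)
      volume 0 1 := ⟨hint.1.im, hint.2.im⟩
  have hx1 : 1 / x ≤ 1 := by rw [div_le_one hx0]; exact hx.le
  have hxp : 0 < 1 / x := by positivity
  have hmem : 1 / x ∈ uIcc (0 : ℝ) 1 := by
    rw [uIcc_of_le zero_le_one]
    exact ⟨hxp.le, hx1⟩
  have e1 : ∫ t in (0 : ℝ)..(1 / x), (Complex.log (1 - (t : ℂ) * x) / (t : ℂ)).im = 0 := by
    refine intervalIntegral.integral_zero_ae (Eventually.of_forall fun t ht => ?_)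
    rw [uIoc_of_le hxp.le] at ht
    have : t * x ≤ 1 := by rw [← le_div_iff₀ hx0]; exact ht.2
    rw [him, Complex.arg_ofReal_of_nonneg (by linarith), zero_div]
  have e2 : ∫ t in (1 / x)..1, (Complex.log (1 - (t : ℂ) * x) / (t : ℂ)).im =
      ∫ t in (1 / x)..1, Real.pi * t⁻¹ := by
    refine intervalIntegral.integral_congr_ae (Eventually.of_forall fun t ht => ?_)
    rw [uIoc_of_le hx1] at ht
    have : 1 < t * x := by rw [← div_lt_iff₀ hx0]; exact ht.1
    rw [him, Complex.arg_ofReal_of_neg (by linarith), div_eq_mul_inv]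
  rw [dilog, Complex.neg_im, h1, ← intervalIntegral.integral_add_adjacent_intervals
    (hint'.mono_set (uIcc_subset_uIcc left_mem_uIcc hmem))
    (hint'.mono_set (uIcc_subset_uIcc hmem right_mem_uIcc)), e1, e2,
    intervalIntegral.integral_const_mul, integral_inv_of_pos hxp one_pos]
  simp

/-- For $x>1$ the term $\arg(1-x)\log x=\pi\log x$ compensates the imaginary part of the dilogarithm
on its cut. -/
theorem blochWignerC_ofReal (x : ℝ) : blochWignerC x = 0 := by
  rw [blochWignerC, show (1 - (x : ℂ)) = ((1 - x : ℝ) : ℂ) by push_cast; rfl]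
  rcases le_or_gt x 1 with h | h
  · rw [Complex.arg_ofReal_of_nonneg (by linarith), dilog_ofReal_im_of_le_one h]
    simp
  · rw [Complex.arg_ofReal_of_neg (by linarith), dilog_ofReal_im_of_one_lt h, Complex.norm_real,
      Real.norm_eq_abs, Real.log_abs]
    ring

theorem blochWignerC_zero : blochWignerC 0 = 0 := by simpa using blochWignerC_ofReal 0

theorem blochWignerC_one : blochWignerC 1 = 0 := by simpa using blochWignerC_ofReal 1

/-! ### Inversion, reflection and smoothness away from 0 and 1. -/

theorem eqOn_of_hasFDerivAt_zero {s : Set ℂ} (hs : IsOpen s) (hs' : IsPreconnected s)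
    {f : ℂ → ℝ} (hf : ∀ z ∈ s, HasFDerivAt f (0 : ℂ →L[ℝ] ℝ) z) {z w : ℂ} (hz : z ∈ s)
    (hw : w ∈ s) : f z = f w := by
  obtain ⟨a, ha⟩ := hs.exists_is_const_of_fderiv_eq_zero hs'
    (fun z hz => (hf z hz).differentiableAt.differentiableWithinAt) fun z hz => (hf z hz).fderiv
  rw [ha z hz, ha w hw]

theorem blochWignerDeriv_comp (w f' : ℂ) :
    (blochWignerDeriv w).comp (f' • ContinuousLinearMap.id ℝ ℂ) =
      Real.log ‖w‖ • imMul (-f' / (1 - w)) - Real.log ‖1 - w‖ • imMul (f' / w) := by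
  ext1 v
  simp only [blochWignerDeriv, ContinuousLinearMap.comp_apply, sub_apply,
    smul_apply, imMul_apply, ContinuousLinearMap.id_apply, smul_eq_mul,
    ← mul_assoc, div_mul_eq_mul_div, neg_mul, one_mul]

theorem blochWignerDeriv_inv_comp {z : ℂ} (h0 : z ≠ 0) (h1 : z ≠ 1) :
    (blochWignerDeriv z⁻¹).comp ((-(z ^ 2)⁻¹) • ContinuousLinearMap.id ℝ ℂ) =
      -blochWignerDeriv z := by
  have h2 : 1 - z ≠ 0 := sub_ne_zero.2 h1.symm
  have h2' : z - 1 ≠ 0 := sub_ne_zero.2 h1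
  have e1 : - -(z ^ 2)⁻¹ / (1 - z⁻¹) = -1 / (1 - z) - 1 / z := by
    have : 1 - z⁻¹ = (z - 1) / z := by field_simp
    rw [this]
    field_simp
    ring
  have e2 : -(z ^ 2)⁻¹ / z⁻¹ = -(1 / z) := by field_simp
  have e3 : ‖1 - z⁻¹‖ = ‖1 - z‖ / ‖z‖ := by
    rw [← norm_div, ← norm_neg]
    congr 1
    field_simp
    ring
  rw [blochWignerDeriv_comp, e1, e2, e3, norm_inv, Real.log_inv,
    Real.log_div (norm_ne_zero_iff.2 h2) (norm_ne_zero_iff.2 h0)]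
  ext1 v
  simp only [blochWignerDeriv, sub_apply, neg_apply,
    smul_apply, imMul_apply, smul_eq_mul, sub_mul, neg_mul, Complex.sub_im,
    Complex.neg_im]
  ring

theorem hasFDerivAt_inv_restrictScalars {z : ℂ} (h0 : z ≠ 0) :
    HasFDerivAt (fun w : ℂ => w⁻¹) ((-(z ^ 2)⁻¹) • ContinuousLinearMap.id ℝ ℂ) z := by
  refine ((hasDerivAt_inv h0).hasFDerivAt.restrictScalars ℝ).congr_fderiv ?_
  ext
  all_goals simp [mul_comm]

theorem one_sub_mem_slitPlane_of_neg_mem {z : ℂ} (hz : -z ∈ Complex.slitPlane) :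
    1 - z ∈ Complex.slitPlane := by
  rcases hz with h | h
  · left
    simp at h ⊢
    linarith
  · right
    simpa using h

/-- At this stage the differential is known only off $[1,\infty)$. Both $z$ and $1/z$ avoid that cut
when $z\notin[0,\infty)$; this domain is connected and contains the fixed point $-1$. On
$[0,\infty)$ both sides vanish. -/
theorem blochWignerC_inv (z : ℂ) : blochWignerC z⁻¹ = -blochWignerC z := by
  by_cases hz : -z ∈ Complex.slitPlane
  · have hopen : IsOpen {w : ℂ | -w ∈ Complex.slitPlane} :=
      Complex.isOpen_slitPlane.preimage continuous_neg
    have hconn : IsPreconnected {w : ℂ | -w ∈ Complex.slitPlane} := by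
      have := (Complex.starConvex_one_slitPlane.isPathConnected
        Complex.one_mem_slitPlane).isConnected.isPreconnected
      have h2 := this.image _ continuous_neg.continuousOn
      rwa [image_neg_eq_neg] at h2
    have key := eqOn_of_hasFDerivAt_zero hopen hconn
      (f := fun w => blochWignerC w⁻¹ + blochWignerC w) ?_ hz (w := -1) (by simp)
    · have h3 : blochWignerC (-1) = 0 := by simpa using blochWignerC_ofReal (-1)
      have h4 : (-1 : ℂ)⁻¹ = -1 := by norm_num
      simp only [h4, h3] at key
      linarith
    · intro w hw
      have hw0 : w ≠ 0 := by
        rintro rfl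
        exact Complex.slitPlane_ne_zero hw neg_zero
      have hw1 : w ≠ 1 := by
        rintro rfl
        rcases hw with h | h
        · simp at h
          linarith
        · simp at h
      have hwi : -w⁻¹ ∈ Complex.slitPlane := by
        rw [← inv_neg, Complex.mem_slitPlane_iff_arg]
        replace hw := Complex.mem_slitPlane_iff_arg.1 hw
        rw [Complex.arg_inv, if_neg hw.1]
        refine ⟨fun h => ?_, inv_ne_zero hw.2⟩
        linarith [Complex.neg_pi_lt_arg (-w)]
      have h1 := (hasFDerivAt_blochWignerC_of_mem_slitPlane
        (one_sub_mem_slitPlane_of_neg_mem hwi) (inv_ne_zero hw0)).comp w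
        (hasFDerivAt_inv_restrictScalars hw0)
      rw [blochWignerDeriv_inv_comp hw0 hw1] at h1
      have h2 := h1.add (hasFDerivAt_blochWignerC_of_mem_slitPlane
        (one_sub_mem_slitPlane_of_neg_mem hw) hw0)
      rw [neg_add_cancel] at h2
      exact h2
  · rw [Complex.mem_slitPlane_iff] at hz
    push Not at hz
    have : z = (z.re : ℂ) := Complex.ext rfl (by simpa using hz.2)
    rw [this, ← Complex.ofReal_inv, blochWignerC_ofReal, blochWignerC_ofReal, neg_zero]

/-- Inversion carries the cut $(1,\infty)$ to $(0,1)$, where the differential is already known; this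
is how the cut is shown to be invisible. -/
theorem hasFDerivAt_blochWignerC {z : ℂ} (h0 : z ≠ 0) (h1 : z ≠ 1) :
    HasFDerivAt blochWignerC (blochWignerDeriv z) z := by
  by_cases hz : 1 - z ∈ Complex.slitPlane
  · exact hasFDerivAt_blochWignerC_of_mem_slitPlane hz h0
  · have hz' : 1 - z⁻¹ ∈ Complex.slitPlane := by
      rw [Complex.mem_slitPlane_iff] at hz
      push Not at hz
      have him : z.im = 0 := by simpa using hz.2
      have hre : 1 ≤ z.re := by simpa using hz.1
      have hzr : z = (z.re : ℂ) := Complex.ext rfl (by simpa using him)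
      have hne : z.re ≠ 1 := fun h => h1 (by rw [hzr, h]; simp)
      rw [hzr, ← Complex.ofReal_inv, ← Complex.ofReal_one, ← Complex.ofReal_sub,
        Complex.ofReal_mem_slitPlane, sub_pos]
      exact inv_lt_one_of_one_lt₀ (lt_of_le_of_ne hre hne.symm)
    have h2 := ((hasFDerivAt_blochWignerC_of_mem_slitPlane hz' (inv_ne_zero h0)).comp z
        (hasFDerivAt_inv_restrictScalars h0)).neg
    rw [blochWignerDeriv_inv_comp h0 h1, neg_neg] at h2
    refine h2.congr_of_eventuallyEq (Eventually.of_forall fun w => ?_)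
    simp [blochWignerC_inv]

theorem hasFDerivAt_blochWignerC_comp {f : ℂ → ℂ} {f' z : ℂ} (hf : HasDerivAt f f' z)
    (h0 : f z ≠ 0) (h1 : f z ≠ 1) :
    HasFDerivAt (fun w => blochWignerC (f w))
      (Real.log ‖f z‖ • imMul (-f' / (1 - f z)) - Real.log ‖1 - f z‖ • imMul (f' / f z)) z := by
  rw [← blochWignerDeriv_comp]
  refine ((hasFDerivAt_blochWignerC h0 h1).comp z
    (hf.hasFDerivAt.restrictScalars ℝ)).congr_fderiv ?_
  congr 1
  ext
  all_goals simp [mul_comm]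

/-- The sum of the two values has zero derivative on the connected set $\mathbb C\setminus\{0,1\}$,
and vanishes at the fixed point $1/2$. -/
theorem blochWignerC_one_sub (z : ℂ) : blochWignerC (1 - z) = -blochWignerC z := by
  by_cases h0 : z = 0
  · simp [h0, blochWignerC_zero, blochWignerC_one]
  by_cases h1 : z = 1
  · simp [h1, blochWignerC_zero, blochWignerC_one]
  have hcount : ({0, 1} : Set ℂ).Countable := (Set.toFinite _).countable
  have hconn := (hcount.isConnected_compl_of_one_lt_rank
    (by rw [Complex.rank_real_complex]; exact Nat.one_lt_ofNat)).isPreconnected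
  have hopen : IsOpen ({0, 1}ᶜ : Set ℂ) := (Set.toFinite _).isClosed.isOpen_compl
  have key := eqOn_of_hasFDerivAt_zero hopen hconn
    (f := fun w => blochWignerC (1 - w) + blochWignerC w) (z := z) (w := 1 / 2) ?_
    (by simp [h0, h1]) (by norm_num)
  · have h2 : blochWignerC (1 / 2) = 0 := by simpa using blochWignerC_ofReal (1 / 2)
    have h4 : (1 - 1 / 2 : ℂ) = 1 / 2 := by norm_num
    simp only [h4, h2] at key
    linarith
  · intro w hw
    simp only [mem_compl_iff, mem_insert_iff, mem_singleton_iff, not_or] at hw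
    have h2 : 1 - w ≠ 0 := sub_ne_zero.2 (Ne.symm hw.2)
    have h3 := hasFDerivAt_blochWignerC_comp ((hasDerivAt_id w).const_sub 1) h2
      (by simpa using hw.1)
    refine (h3.add (hasFDerivAt_blochWignerC hw.1 hw.2)).congr_fderiv ?_
    ext1 v
    simp [blochWignerDeriv]

theorem continuousAt_blochWignerC_zero : ContinuousAt blochWignerC 0 := by
  have hs : (1 : ℂ) - 0 ∈ Complex.slitPlane := by simp
  have h1 : Tendsto (fun z => (dilog z).im) (𝓝 0) (𝓝 0) := by
    have := (Complex.continuous_im.continuousAt.comp (hasDerivAt_dilog_integral hs).continuousAt)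
    have h2 : (dilog 0).im = 0 := by simpa using dilog_ofReal_im_of_le_one (zero_le_one)
    simpa [ContinuousAt, h2, Function.comp_def] using this.tendsto
  have h2 : Tendsto (fun z : ℂ => Complex.arg (1 - z) * Real.log ‖z‖) (𝓝 0) (𝓝 0) := by
    -- The factor $\arg(1-z)$ vanishes to first order at $0$, and $|z|\log|z|\to0$.
    have hO : (fun z : ℂ => Complex.arg (1 - z)) =O[𝓝 0] fun z => ‖z‖ := by
      have := (hasFDerivAt_im_of_hasDerivAt (((hasDerivAt_id (0 : ℂ)).const_sub 1).clog
        hs)).isBigO_sub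
      simpa [Complex.log_im] using this.norm_right
    have h3 := hO.mul (Asymptotics.isBigO_refl (fun z : ℂ => Real.log ‖z‖) (𝓝 0))
    refine h3.trans_tendsto ?_
    have h4 := Real.continuous_mul_log.tendsto 0
    simp only [zero_mul] at h4
    exact h4.comp (by simpa using (continuous_norm (E := ℂ)).tendsto 0)
  have h3 := h2.add h1
  rw [ContinuousAt, blochWignerC_zero]
  rw [add_zero] at h3
  exact h3

theorem tendsto_blochWignerC_one : Tendsto blochWignerC (𝓝 1) (𝓝 0) := by
  have h1 : Tendsto (fun z : ℂ => 1 - z) (𝓝 1) (𝓝 0) := by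
    simpa using (continuous_sub_left (1 : ℂ)).tendsto 1
  have h2 := (continuousAt_blochWignerC_zero.tendsto.comp h1).neg
  rw [blochWignerC_zero, neg_zero] at h2
  refine h2.congr fun z => ?_
  simp [blochWignerC_one_sub]

/-- One differentiation suffices: the derivative is an explicit smooth expression in $\log|z|$,
$\log|1-z|$, $1/z$ and $1/(1-z)$. -/
theorem contDiffOn_blochWignerC :
    ContDiffOn ℝ ((⊤ : ℕ∞) : WithTop ℕ∞) blochWignerC ({0, 1}ᶜ : Set ℂ) := by
  have hopen : IsOpen ({0, 1}ᶜ : Set ℂ) := (Set.toFinite _).isClosed.isOpen_compl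
  rw [contDiffOn_infty_iff_fderiv_of_isOpen hopen]
  have hne : ∀ z ∈ ({0, 1}ᶜ : Set ℂ), z ≠ 0 ∧ 1 - z ≠ 0 := fun z hz => by
    simp only [mem_compl_iff, mem_insert_iff, mem_singleton_iff, not_or] at hz
    exact ⟨hz.1, sub_ne_zero.2 (Ne.symm hz.2)⟩
  have hd : ∀ z ∈ ({0, 1}ᶜ : Set ℂ), HasFDerivAt blochWignerC (blochWignerDeriv z) z :=
    fun z hz => hasFDerivAt_blochWignerC (hne z hz).1 (sub_ne_zero.1 (hne z hz).2).symm
  refine ⟨fun z hz => (hd z hz).differentiableAt.differentiableWithinAt, ?_⟩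
  refine ContDiffOn.congr ?_ fun z hz => (hd z hz).fderiv
  have him : ∀ f : ℂ → ℂ, ContDiffOn ℝ ((⊤ : ℕ∞) : WithTop ℕ∞) f ({0, 1}ᶜ : Set ℂ) →
      ContDiffOn ℝ ((⊤ : ℕ∞) : WithTop ℕ∞) (fun z => imMul (f z)) ({0, 1}ᶜ : Set ℂ) :=
    fun f hf => contDiffOn_const.clm_comp (hf.smul contDiffOn_const)
  unfold blochWignerDeriv
  refine ContDiffOn.sub (ContDiffOn.fun_smul ?_ (him _ ?_)) (ContDiffOn.fun_smul ?_ (him _ ?_))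
  · exact (contDiffOn_id.norm ℝ fun z hz => (hne z hz).1).log
      fun z hz => norm_ne_zero_iff.2 (hne z hz).1
  · simp only [div_eq_mul_inv]
    exact contDiffOn_const.mul ((contDiffOn_const.sub contDiffOn_id).inv fun z hz => (hne z hz).2)
  · exact ((contDiffOn_const.sub contDiffOn_id).norm ℝ fun z hz => (hne z hz).2).log
      fun z hz => norm_ne_zero_iff.2 (hne z hz).2
  · exact (contDiffOn_id.inv fun z hz => (hne z hz).1).congr fun z _ => one_div z

/-! ### The dilogarithm of the cross-ratio as an alternating function. -/

/-- The Bloch–Wigner dilogarithm in homogeneous coordinates `[x : y]`, with value `0` at `[0 : 0]`. -/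
def blochWignerHom (x y : ℂ) : ℝ := if y = 0 then 0 else blochWignerC (x / y)

theorem blochWignerHom_of_ne {x y : ℂ} (h : y ≠ 0) : blochWignerHom x y = blochWignerC (x / y) :=
  if_neg h

/-- Vanishing coordinates are allowed because $D_2$ is $0$ at $0$ and $\infty$. This is what frees
the cross-ratio symmetries below from distinctness hypotheses. -/
theorem blochWignerHom_swap (x y : ℂ) : blochWignerHom y x = -blochWignerHom x y := by
  unfold blochWignerHom
  split_ifs with h1 h2 h2
  · simp
  · simp [h1, blochWignerC_zero]
  · simp [h2, blochWignerC_zero]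
  · rw [← blochWignerC_inv, inv_div]

theorem blochWignerHom_sub (x y : ℂ) : blochWignerHom (y - x) y = -blochWignerHom x y := by
  unfold blochWignerHom
  split_ifs with h
  · simp
  · rw [sub_div, div_self h, blochWignerC_one_sub]

theorem blochWignerHom_mul_left {k : ℂ} (hk : k ≠ 0) (x y : ℂ) :
    blochWignerHom (k * x) (k * y) = blochWignerHom x y := by
  simp only [blochWignerHom, mul_eq_zero, hk, false_or, mul_div_mul_left _ _ hk]

theorem blochWignerHom_neg_sub (x y : ℂ) : blochWignerHom (-x) (y - x) = -blochWignerHom x y := by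
  have h := blochWignerHom_sub (-x) (y - x)
  rw [sub_neg_eq_add, sub_add_cancel, blochWignerHom_swap, blochWignerHom_sub] at h
  linarith

/-- The dilogarithm of the cross-ratio of four points. -/
def crossDilog (a b c d : OnePoint ℂ) : ℝ := blochWigner (crossRatio a b c d)

theorem crossDilog_eq (a b c d : OnePoint ℂ) :
    crossDilog a b c d =
      blochWignerHom (bracket a b * bracket c d) (bracket a c * bracket b d) := by
  unfold crossDilog crossRatio blochWignerHom
  split_ifs <;> rfl

theorem bracket_swap (a b : OnePoint ℂ) : bracket b a = -bracket a b := by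
  simp only [bracket]
  ring

/-- Divided by $[ac][bd]$, this evaluates $1$ minus the cross-ratio, so that transposing points
becomes a substitution in homogeneous coordinates. -/
theorem bracket_plucker (a b c d : OnePoint ℂ) :
    bracket a d * bracket b c = bracket a c * bracket b d - bracket a b * bracket c d := by
  simp only [bracket]
  ring

theorem crossDilog_swap₁₂ (a b c d : OnePoint ℂ) :
    crossDilog b a c d = -crossDilog a b c d := by
  rw [crossDilog_eq, crossDilog_eq, bracket_swap a b, mul_comm (bracket b c), bracket_plucker,
    neg_mul, blochWignerHom_neg_sub]

theorem crossDilog_swap₂₃ (a b c d : OnePoint ℂ) :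
    crossDilog a c b d = -crossDilog a b c d := by
  rw [crossDilog_eq, crossDilog_eq, blochWignerHom_swap]

theorem crossDilog_swap₃₄ (a b c d : OnePoint ℂ) :
    crossDilog a b d c = -crossDilog a b c d := by
  rw [crossDilog_eq, crossDilog_eq, bracket_swap c d, bracket_plucker,
    mul_neg, blochWignerHom_neg_sub]

@[simp]
theorem bracket_infty_right (z : ℂ) : bracket (z : OnePoint ℂ) ∞ = -1 := by
  simp [bracket, homog]

@[simp]
theorem bracket_coe (z w : ℂ) : bracket (z : OnePoint ℂ) (w : OnePoint ℂ) = z - w := by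
  simp [bracket, homog]

theorem crossDilog_coe_infty {a b c : ℂ} (h : a ≠ c) :
    crossDilog a b c ∞ = blochWignerC ((a - b) / (a - c)) := by
  rw [crossDilog_eq]
  simp only [bracket_coe, bracket_infty_right, mul_neg_one]
  rw [blochWignerHom_of_ne (neg_ne_zero.2 (sub_ne_zero.2 h)), neg_div_neg_eq]

theorem crossDilog_coe {a b c d : ℂ} (h : a ≠ c) (h' : b ≠ d) :
    crossDilog a b c d = blochWignerC ((a - b) * (c - d) / ((a - c) * (b - d))) := by
  rw [crossDilog_eq, blochWignerHom_of_ne]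
  · simp
  · simpa [sub_eq_zero] using ⟨h, h'⟩

/-! ### The five-term relation at points in general position. -/

/-- The alternating sum of the dilogarithms of the five cross-ratios of five points. -/
def fiveTerm (x₀ x₁ x₂ x₃ x₄ : OnePoint ℂ) : ℝ :=
  crossDilog x₁ x₂ x₃ x₄ - crossDilog x₀ x₂ x₃ x₄ + crossDilog x₀ x₁ x₃ x₄ -
    crossDilog x₀ x₁ x₂ x₄ + crossDilog x₀ x₁ x₂ x₃

/-- All logarithms are split into those of differences of points, so that the differentials in the
five-term sum cancel by linear algebra. The differential of $\hat\omega^2$ uses the same form. -/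
theorem hasFDerivAt_blochWignerC_div {z p q : ℂ} (hp : z ≠ p) (hq : z ≠ q) (hpq : p ≠ q) :
    HasFDerivAt (fun w => blochWignerC ((w - p) / (w - q)))
      (-(Real.log ‖z - p‖ • imMul (1 / (z - q))) + Real.log ‖z - q‖ • imMul (1 / (z - p)) -
        Real.log ‖p - q‖ • (imMul (1 / (z - p)) - imMul (1 / (z - q)))) z := by
  have hp' := sub_ne_zero.2 hp
  have hq' := sub_ne_zero.2 hq
  have hpq' := sub_ne_zero.2 hpq
  have h1 : HasDerivAt (fun w => (w - p) / (w - q)) ((p - q) / (z - q) ^ 2) z := by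
    refine (((hasDerivAt_id z).sub_const p).div ((hasDerivAt_id z).sub_const q) hq').congr_deriv ?_
    simp only [id]
    congr 1
    ring
  have e : 1 - (z - p) / (z - q) = (p - q) / (z - q) := by
    field_simp
    ring
  have hne : 1 - (z - p) / (z - q) ≠ 0 := by
    rw [e]
    exact div_ne_zero hpq' hq'
  refine (hasFDerivAt_blochWignerC_comp h1 (div_ne_zero hp' hq')
    (sub_ne_zero.1 hne).symm).congr_fderiv ?_
  have e1 : -((p - q) / (z - q) ^ 2) / (1 - (z - p) / (z - q)) = -(1 / (z - q)) := by
    rw [e]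
    field_simp
  have e2 : (p - q) / (z - q) ^ 2 / ((z - p) / (z - q)) = 1 / (z - p) - 1 / (z - q) := by
    field_simp
    ring
  rw [e1, e2, e, norm_div, norm_div, Real.log_div (norm_ne_zero_iff.2 hp') (norm_ne_zero_iff.2 hq'),
    Real.log_div (norm_ne_zero_iff.2 hpq') (norm_ne_zero_iff.2 hq')]
  ext1 v
  simp only [add_apply, sub_apply, neg_apply, smul_apply, imMul_apply, smul_eq_mul, sub_mul,
    neg_mul, Complex.sub_im, Complex.neg_im]
  ring

theorem hasFDerivAt_blochWignerC_cross {z p q r : ℂ} (hp : z ≠ p) (hq : z ≠ q) (hr : z ≠ r)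
    (hpq : p ≠ q) (hpr : p ≠ r) (hqr : q ≠ r) :
    HasFDerivAt (fun w => blochWignerC ((w - p) * (q - r) / ((w - q) * (p - r))))
      ((Real.log ‖z - p‖ + Real.log ‖q - r‖ - Real.log ‖z - q‖ - Real.log ‖p - r‖) •
          (imMul (1 / (z - r)) - imMul (1 / (z - q))) -
        (Real.log ‖z - r‖ + Real.log ‖p - q‖ - Real.log ‖z - q‖ - Real.log ‖p - r‖) •
          (imMul (1 / (z - p)) - imMul (1 / (z - q)))) z := by
  have hp' := sub_ne_zero.2 hp
  have hq' := sub_ne_zero.2 hq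
  have hr' := sub_ne_zero.2 hr
  have hpq' := sub_ne_zero.2 hpq
  have hpr' := sub_ne_zero.2 hpr
  have hqr' := sub_ne_zero.2 hqr
  have h1 : HasDerivAt (fun w => (w - p) * (q - r) / ((w - q) * (p - r)))
      ((p - q) * (q - r) / ((z - q) ^ 2 * (p - r))) z := by
    refine ((((hasDerivAt_id z).sub_const p).mul_const (q - r)).div
      (((hasDerivAt_id z).sub_const q).mul_const (p - r)) (mul_ne_zero hq' hpr')).congr_deriv ?_
    simp only [id]
    field_simp
    ring
  have e : 1 - (z - p) * (q - r) / ((z - q) * (p - r)) =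
      (z - r) * (p - q) / ((z - q) * (p - r)) := by
    field_simp
    ring
  have hne : 1 - (z - p) * (q - r) / ((z - q) * (p - r)) ≠ 0 := by
    rw [e]
    exact div_ne_zero (mul_ne_zero hr' hpq') (mul_ne_zero hq' hpr')
  refine (hasFDerivAt_blochWignerC_comp h1 (div_ne_zero (mul_ne_zero hp' hqr')
    (mul_ne_zero hq' hpr')) (sub_ne_zero.1 hne).symm).congr_fderiv ?_
  have e1 : -((p - q) * (q - r) / ((z - q) ^ 2 * (p - r))) /
      (1 - (z - p) * (q - r) / ((z - q) * (p - r))) = 1 / (z - r) - 1 / (z - q) := by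
    rw [e]
    field_simp
    ring
  have e2 : (p - q) * (q - r) / ((z - q) ^ 2 * (p - r)) /
      ((z - p) * (q - r) / ((z - q) * (p - r))) = 1 / (z - p) - 1 / (z - q) := by
    field_simp
    ring
  rw [e1, e2, e]
  simp only [norm_div, norm_mul]
  rw [← norm_ne_zero_iff] at hp' hq' hr' hpq' hpr' hqr'
  rw [Real.log_div (mul_ne_zero hp' hqr') (mul_ne_zero hq' hpr'),
    Real.log_div (mul_ne_zero hr' hpq') (mul_ne_zero hq' hpr'), Real.log_mul hp' hqr',
    Real.log_mul hq' hpr', Real.log_mul hr' hpq']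
  ext1 v
  simp only [sub_apply, smul_apply, imMul_apply, smul_eq_mul, sub_mul, Complex.sub_im]
  ring

theorem tendsto_sub_div_sub_cobounded (p q : ℂ) :
    Tendsto (fun z : ℂ => (z - p) / (z - q)) (Bornology.cobounded ℂ) (𝓝 1) := by
  have h1 : Tendsto (fun z : ℂ => z - q) (Bornology.cobounded ℂ) (Bornology.cobounded ℂ) := by
    simp [sub_eq_add_neg]
  have h2 := ((tendsto_inv₀_cobounded.comp h1).const_mul (q - p)).const_add 1
  rw [mul_zero, add_zero] at h2
  refine h2.congr' ?_
  filter_upwards [Bornology.isBounded_def.1 (Set.finite_singleton q).isBounded] with z hz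
  have : z - q ≠ 0 := sub_ne_zero.2 hz
  simp only [Function.comp_apply]
  field_simp
  ring

/-- As a function of $z$ the sum has zero derivative on the connected complement of three points. As
$z\to\infty$ three terms tend to $D_2(1)=0$, and the other two to $D_2(x)+D_2(1-x)=0$ with
$x=(p-q)/(p-r)$. -/
theorem fiveTerm_coe_infty {z p q r : ℂ} (hp : z ≠ p) (hq : z ≠ q) (hr : z ≠ r)
    (hpq : p ≠ q) (hpr : p ≠ r) (hqr : q ≠ r) : fiveTerm z p q r ∞ = 0 := by
  set s : Set ℂ := {p, q, r}ᶜ with hs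
  have hmem : ∀ w, w ∈ s ↔ w ≠ p ∧ w ≠ q ∧ w ≠ r := fun w => by simp [hs]
  have hfin : ({p, q, r} : Set ℂ).Finite := Set.toFinite _
  have hconn : IsPreconnected s := (hfin.countable.isConnected_compl_of_one_lt_rank
    (by rw [Complex.rank_real_complex]; exact Nat.one_lt_ofNat)).isPreconnected
  have hopen : IsOpen s := hfin.isClosed.isOpen_compl
  let G : ℂ → ℝ := fun w => blochWignerC ((p - q) / (p - r)) - blochWignerC ((w - q) / (w - r)) +
    blochWignerC ((w - p) / (w - r)) - blochWignerC ((w - p) / (w - q)) +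
    blochWignerC ((w - p) * (q - r) / ((w - q) * (p - r)))
  have hG : fiveTerm z p q r ∞ = G z := by
    rw [fiveTerm, crossDilog_coe_infty hpr, crossDilog_coe_infty hr, crossDilog_coe_infty hr,
      crossDilog_coe_infty hq, crossDilog_coe hq hpr]
  have hconst : ∀ w ∈ s, G w = G z := fun w hw => by
    refine eqOn_of_hasFDerivAt_zero hopen hconn (fun u hu => ?_) hw ((hmem z).2 ⟨hp, hq, hr⟩)
    obtain ⟨up, uq, ur⟩ := (hmem u).1 hu
    refine (((((hasFDerivAt_blochWignerC_div uq ur hqr).const_sub _).add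
      (hasFDerivAt_blochWignerC_div up ur hpr)).sub (hasFDerivAt_blochWignerC_div up uq hpq)).add
      (hasFDerivAt_blochWignerC_cross up uq ur hpq hpr hqr)).congr_fderiv ?_
    ext1 v
    simp only [add_apply, sub_apply, neg_apply, smul_apply, imMul_apply, smul_eq_mul, zero_apply]
    ring
  have h1 : Tendsto G (Bornology.cobounded ℂ) (𝓝 (G z)) := by
    refine tendsto_const_nhds.congr' ?_
    filter_upwards [Bornology.isBounded_def.1 hfin.isBounded] with w hw
    exact (hconst w hw).symm
  have hone : ∀ a b : ℂ, Tendsto (fun w => blochWignerC ((w - a) / (w - b)))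
      (Bornology.cobounded ℂ) (𝓝 0) := fun a b =>
    tendsto_blochWignerC_one.comp (tendsto_sub_div_sub_cobounded a b)
  have h2 : Tendsto (fun w => blochWignerC ((w - p) * (q - r) / ((w - q) * (p - r))))
      (Bornology.cobounded ℂ) (𝓝 (blochWignerC ((q - r) / (p - r)))) := by
    have hpr' := sub_ne_zero.2 hpr
    have hne1 : (q - r) / (p - r) ≠ 1 := by
      rw [Ne, div_eq_one_iff_eq hpr', sub_left_inj]
      exact hpq.symm
    have hc := (hasFDerivAt_blochWignerC (div_ne_zero (sub_ne_zero.2 hqr) hpr') hne1).continuousAt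
    have h3 := (tendsto_sub_div_sub_cobounded p q).mul_const ((q - r) / (p - r))
    rw [one_mul] at h3
    refine (hc.tendsto.comp h3).congr fun w => ?_
    rw [Function.comp_apply, div_mul_div_comm]
  have h3 : Tendsto G (Bornology.cobounded ℂ) (𝓝 (blochWignerC ((p - q) / (p - r)) - 0 + 0 - 0 +
      blochWignerC ((q - r) / (p - r)))) :=
    (((tendsto_const_nhds.sub (hone q r)).add (hone p r)).sub (hone p q)).add h2
  have h4 : (q - r) / (p - r) = 1 - (p - q) / (p - r) := by
    have := sub_ne_zero.2 hpr
    field_simp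
    ring
  rw [hG, tendsto_nhds_unique h1 h3, h4, blochWignerC_one_sub]
  ring

/-! ### Projective invariance and the general five-term relation. -/

theorem mk_smul_coe (A : SL(2, ℂ)) (z : ℂ) :
    (QuotientGroup.mk A : PSL(2, ℂ)) • (z : OnePoint ℂ) =
      if A 1 0 * z + A 1 1 = 0 then ∞ else
        (((A 0 0 * z + A 0 1) / (A 1 0 * z + A 1 1) : ℂ) : OnePoint ℂ) :=
  smul_some_eq_ite

theorem mk_smul_infty (A : SL(2, ℂ)) :
    (QuotientGroup.mk A : PSL(2, ℂ)) • (∞ : OnePoint ℂ) =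
      if A 1 0 = 0 then ∞ else ((A 0 0 / A 1 0 : ℂ) : OnePoint ℂ) :=
  smul_infty_eq_ite _

theorem det_eq (A : SL(2, ℂ)) : A 0 0 * A 1 1 - A 0 1 * A 1 0 = 1 := by
  rw [← Matrix.det_fin_two, A.det_coe]

theorem exists_homog_smul (A : SL(2, ℂ)) (x : OnePoint ℂ) :
    ∃ μ : ℂ, μ ≠ 0 ∧ (homog ((QuotientGroup.mk A : PSL(2, ℂ)) • x)).1 =
        μ * (A 0 0 * (homog x).1 + A 0 1 * (homog x).2) ∧
      (homog ((QuotientGroup.mk A : PSL(2, ℂ)) • x)).2 =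
        μ * (A 1 0 * (homog x).1 + A 1 1 * (homog x).2) := by
  have hdet := det_eq A
  cases x with
  | infty =>
    rw [mk_smul_infty]
    split_ifs with h
    · have h0 : A 0 0 ≠ 0 := by
        rintro h0
        rw [h, h0] at hdet
        simp at hdet
      exact ⟨(A 0 0)⁻¹, inv_ne_zero h0, by simp [homog, h0], by simp [homog, h]⟩
    · exact ⟨(A 1 0)⁻¹, inv_ne_zero h, by simp [homog, div_eq_inv_mul], by simp [homog, h]⟩
  | coe z =>
    rw [mk_smul_coe]
    split_ifs with h
    · have h0 : A 0 0 * z + A 0 1 ≠ 0 := by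
        intro h0
        have : (A 0 0 * z + A 0 1) * A 1 0 - A 0 0 * (A 1 0 * z + A 1 1) = -1 := by
          linear_combination -hdet
        rw [h, h0] at this
        simp at this
      exact ⟨(A 0 0 * z + A 0 1)⁻¹, inv_ne_zero h0, by simp [homog, h0], by simp [homog, h]⟩
    · exact ⟨(A 1 0 * z + A 1 1)⁻¹, inv_ne_zero h, by simp [homog, div_eq_inv_mul],
        by simp [homog, h]⟩

theorem exists_bracket_smul (g : PSL(2, ℂ)) :
    ∃ μ : OnePoint ℂ → ℂ, (∀ a, μ a ≠ 0) ∧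
      ∀ a b, bracket (g • a) (g • b) = μ a * μ b * bracket a b := by
  obtain ⟨A, rfl⟩ := QuotientGroup.mk_surjective g
  choose μ hμ h1 h2 using exists_homog_smul A
  refine ⟨μ, hμ, fun a b => ?_⟩
  unfold bracket
  rw [h1, h1, h2, h2]
  linear_combination (μ a * μ b *
    ((homog a).1 * (homog b).2 - (homog b).1 * (homog a).2)) * det_eq A

/-- Each point occurs once in the numerator and once in the denominator of the cross-ratio, so both
acquire the same product of scale factors. -/
theorem crossDilog_smul (g : PSL(2, ℂ)) (a b c d : OnePoint ℂ) :
    crossDilog (g • a) (g • b) (g • c) (g • d) = crossDilog a b c d := by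
  obtain ⟨μ, hμ, h⟩ := exists_bracket_smul g
  rw [crossDilog_eq, crossDilog_eq, h, h, h, h,
    ← blochWignerHom_mul_left (k := μ a * μ b * μ c * μ d)
      (mul_ne_zero (mul_ne_zero (mul_ne_zero (hμ a) (hμ b)) (hμ c)) (hμ d))
      (bracket a b * bracket c d) (bracket a c * bracket b d)]
  congr 1 <;> ring

theorem fiveTerm_smul (g : PSL(2, ℂ)) (x₀ x₁ x₂ x₃ x₄ : OnePoint ℂ) :
    fiveTerm (g • x₀) (g • x₁) (g • x₂) (g • x₃) (g • x₄) = fiveTerm x₀ x₁ x₂ x₃ x₄ := by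
  simp only [fiveTerm, crossDilog_smul]

theorem exists_smul_eq_infty (x : OnePoint ℂ) : ∃ g : PSL(2, ℂ), g • x = ∞ := by
  cases x with
  | infty => exact ⟨1, one_smul _ _⟩
  | coe z =>
    let A : SL(2, ℂ) := ⟨!![0, -1; 1, -z], by simp [Matrix.det_fin_two]⟩
    refine ⟨QuotientGroup.mk A, ?_⟩
    rw [mk_smul_coe, if_pos]
    simp [A]

/-- Exchanging neighbouring points exchanges the two faces omitting them, which carry opposite
signs, and negates the other three. Alternation then settles every coincidence of points. -/
theorem fiveTerm_swap₀₁ (x₀ x₁ x₂ x₃ x₄ : OnePoint ℂ) :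
    fiveTerm x₁ x₀ x₂ x₃ x₄ = -fiveTerm x₀ x₁ x₂ x₃ x₄ := by
  unfold fiveTerm
  rw [crossDilog_swap₁₂ x₀ x₁ x₃ x₄, crossDilog_swap₁₂ x₀ x₁ x₂ x₄, crossDilog_swap₁₂ x₀ x₁ x₂ x₃]
  ring

theorem fiveTerm_swap₁₂ (x₀ x₁ x₂ x₃ x₄ : OnePoint ℂ) :
    fiveTerm x₀ x₂ x₁ x₃ x₄ = -fiveTerm x₀ x₁ x₂ x₃ x₄ := by
  unfold fiveTerm
  rw [crossDilog_swap₁₂ x₁ x₂ x₃ x₄, crossDilog_swap₂₃ x₀ x₁ x₂ x₄, crossDilog_swap₂₃ x₀ x₁ x₂ x₃]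
  ring

theorem fiveTerm_swap₂₃ (x₀ x₁ x₂ x₃ x₄ : OnePoint ℂ) :
    fiveTerm x₀ x₁ x₃ x₂ x₄ = -fiveTerm x₀ x₁ x₂ x₃ x₄ := by
  unfold fiveTerm
  rw [crossDilog_swap₂₃ x₁ x₂ x₃ x₄, crossDilog_swap₂₃ x₀ x₂ x₃ x₄, crossDilog_swap₃₄ x₀ x₁ x₂ x₃]
  ring

theorem fiveTerm_swap₃₄ (x₀ x₁ x₂ x₃ x₄ : OnePoint ℂ) :
    fiveTerm x₀ x₁ x₂ x₄ x₃ = -fiveTerm x₀ x₁ x₂ x₃ x₄ := by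
  unfold fiveTerm
  rw [crossDilog_swap₃₄ x₁ x₂ x₃ x₄, crossDilog_swap₃₄ x₀ x₂ x₃ x₄, crossDilog_swap₃₄ x₀ x₁ x₃ x₄]
  ring

theorem fiveTerm_eq_zero_of_eq₀₁ (x x₂ x₃ x₄ : OnePoint ℂ) : fiveTerm x x x₂ x₃ x₄ = 0 := by
  linarith [fiveTerm_swap₀₁ x x x₂ x₃ x₄]

theorem fiveTerm_eq_zero_of_eq₀₂ (x x₁ x₃ x₄ : OnePoint ℂ) : fiveTerm x x₁ x x₃ x₄ = 0 := by
  rw [fiveTerm_swap₁₂, fiveTerm_eq_zero_of_eq₀₁, neg_zero]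

theorem fiveTerm_eq_zero_of_eq₀₃ (x x₁ x₂ x₄ : OnePoint ℂ) : fiveTerm x x₁ x₂ x x₄ = 0 := by
  rw [fiveTerm_swap₂₃, fiveTerm_eq_zero_of_eq₀₂, neg_zero]

theorem fiveTerm_eq_zero_of_eq₀₄ (x x₁ x₂ x₃ : OnePoint ℂ) : fiveTerm x x₁ x₂ x₃ x = 0 := by
  rw [fiveTerm_swap₃₄, fiveTerm_eq_zero_of_eq₀₃, neg_zero]

/-- The five-term relation of the Bloch–Wigner dilogarithm, for arbitrary points of `ℙ¹(ℂ)`. -/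
theorem fiveTerm_eq_zero (x₀ x₁ x₂ x₃ x₄ : OnePoint ℂ) : fiveTerm x₀ x₁ x₂ x₃ x₄ = 0 := by
  by_cases h01 : x₀ = x₁
  · rw [h01, fiveTerm_eq_zero_of_eq₀₁]
  by_cases h02 : x₀ = x₂
  · rw [h02, fiveTerm_eq_zero_of_eq₀₂]
  by_cases h03 : x₀ = x₃
  · rw [h03, fiveTerm_eq_zero_of_eq₀₃]
  by_cases h04 : x₀ = x₄
  · rw [h04, fiveTerm_eq_zero_of_eq₀₄]
  by_cases h12 : x₁ = x₂
  · rw [h12, fiveTerm_swap₀₁, fiveTerm_eq_zero_of_eq₀₂, neg_zero]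
  by_cases h13 : x₁ = x₃
  · rw [h13, fiveTerm_swap₀₁, fiveTerm_eq_zero_of_eq₀₃, neg_zero]
  by_cases h14 : x₁ = x₄
  · rw [h14, fiveTerm_swap₀₁, fiveTerm_eq_zero_of_eq₀₄, neg_zero]
  by_cases h23 : x₂ = x₃
  · subst h23
    linarith [fiveTerm_swap₂₃ x₀ x₁ x₂ x₂ x₄]
  by_cases h24 : x₂ = x₄
  · subst h24
    linarith [fiveTerm_swap₃₄ x₀ x₁ x₂ x₃ x₂, fiveTerm_swap₂₃ x₀ x₁ x₂ x₂ x₃]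
  by_cases h34 : x₃ = x₄
  · subst h34
    linarith [fiveTerm_swap₃₄ x₀ x₁ x₂ x₃ x₃]
  -- The points are now distinct; moving the last to $\infty$ reduces to the affine case.
  obtain ⟨g, hg⟩ := exists_smul_eq_infty x₄
  have hne : ∀ x, x ≠ x₄ → ∃ z : ℂ, g • x = z := fun x hx => by
    have : g • x ≠ ∞ := fun h => hx (smul_left_cancel g (h.trans hg.symm))
    exact ⟨_, (OnePoint.ne_infty_iff_exists.1 this).choose_spec.symm⟩
  obtain ⟨z, hz⟩ := hne x₀ h04
  obtain ⟨p, hp⟩ := hne x₁ h14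
  obtain ⟨q, hq⟩ := hne x₂ h24
  obtain ⟨r, hr⟩ := hne x₃ h34
  have hinj : ∀ {x y : OnePoint ℂ} {a b : ℂ}, g • x = a → g • y = b → x ≠ y → a ≠ b :=
    fun ha hb hxy hab => hxy (smul_left_cancel g (by rw [ha, hb, hab]))
  rw [← fiveTerm_smul g, hg, hz, hp, hq, hr]
  exact fiveTerm_coe_infty (hinj hz hp h01) (hinj hz hq h02) (hinj hz hr h03) (hinj hp hq h12)
    (hinj hp hr h13) (hinj hq hr h23)

theorem L2_crossRatio (a b c d : OnePoint ℂ) :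
    L2 (crossRatio a b c d) = Complex.I * (crossDilog a b c d : ℂ) := rfl

/-! ### The regulator cocycle. -/

/-- The freedom to translate by `h` lets the faces of a simplex be placed on common vertices. -/
theorem regulator_eq (g : Fin 3 → PSL(2, ℂ)) (h : PSL(2, ℂ)) :
    regulator g = Complex.I * (crossDilog (h • (∞ : OnePoint ℂ)) ((h * g 0) • (∞ : OnePoint ℂ))
      ((h * g 0 * g 1) • (∞ : OnePoint ℂ)) ((h * g 0 * g 1 * g 2) • (∞ : OnePoint ℂ)) : ℂ) := by
  simp only [mul_smul]
  rw [crossDilog_smul, regulator, L2_crossRatio]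
  simp only [mul_smul]

theorem coboundary_three {G A : Type*} [Group G] [AddCommGroup A] (act : G → A → A)
    (c : (Fin 3 → G) → A) (g : Fin 4 → G) :
    coboundary act c g = c ![g 1, g 2, g 3] - c ![g 0 * g 1, g 2, g 3] + c ![g 0, g 1 * g 2, g 3]
      - c ![g 0, g 1, g 2 * g 3] + act (g 3) (c ![g 0, g 1, g 2]) := by
  have e0 : Fin.tail g = ![g 1, g 2, g 3] := by
    ext i; fin_cases i <;> rfl
  have e1 : Fin.contractNth (Fin.castSucc (0 : Fin 3)) (· * ·) g = ![g 0 * g 1, g 2, g 3] := by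
    ext i; fin_cases i <;> rfl
  have e2 : Fin.contractNth (Fin.castSucc (1 : Fin 3)) (· * ·) g = ![g 0, g 1 * g 2, g 3] := by
    ext i; fin_cases i <;> rfl
  have e3 : Fin.contractNth (Fin.castSucc (2 : Fin 3)) (· * ·) g = ![g 0, g 1, g 2 * g 3] := by
    ext i; fin_cases i <;> rfl
  have e4 : Fin.init g = ![g 0, g 1, g 2] := by
    ext i; fin_cases i <;> rfl
  rw [coboundary, Fin.sum_univ_three, e0, e1, e2, e3, e4]
  simp [Fin.last]
  abel

/-- The five terms are the faces of the simplex with vertices $\infty$ and its successive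
translates; the face omitting $\infty$ needs translation by `g 0`. -/
theorem coboundary_regulator :
    coboundary (fun (_ : PSL(2, ℂ)) (a : ℂ) => a) regulator = 0 := by
  funext g
  rw [coboundary_three, regulator_eq _ (g 0), regulator_eq ![g 0 * g 1, g 2, g 3] 1,
    regulator_eq ![g 0, g 1 * g 2, g 3] 1, regulator_eq ![g 0, g 1, g 2 * g 3] 1,
    regulator_eq ![g 0, g 1, g 2] 1]
  have h := congrArg (fun x : ℝ => Complex.I * (x : ℂ)) (fiveTerm_eq_zero ∞
    (g 0 • (∞ : OnePoint ℂ)) ((g 0 * g 1) • (∞ : OnePoint ℂ))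
    ((g 0 * g 1 * g 2) • (∞ : OnePoint ℂ)) ((g 0 * g 1 * g 2 * g 3) • (∞ : OnePoint ℂ)))
  simp only [fiveTerm] at h
  push_cast at h
  simp only [Matrix.cons_val_zero, Matrix.cons_val_one, Matrix.cons_val, one_mul, one_smul,
    ← mul_assoc, Pi.zero_apply]
  linear_combination h

/-! ### Continuity of the action; invariance and openness of $U_\Gamma$. -/

theorem continuousAt_mk_smul_coe (A : SL(2, ℂ)) (z : ℂ) :
    ContinuousAt (fun x : OnePoint ℂ => (QuotientGroup.mk A : PSL(2, ℂ)) • x)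
      (z : OnePoint ℂ) := by
  rw [OnePoint.continuousAt_coe]
  have hden : ContinuousAt (fun w : ℂ => A 1 0 * w + A 1 1) z := by fun_prop
  have hnum : ContinuousAt (fun w : ℂ => A 0 0 * w + A 0 1) z := by fun_prop
  by_cases h : A 1 0 * z + A 1 1 = 0
  · have hdet := det_eq A
    have hc : A 1 0 ≠ 0 := by
      intro hc
      rw [hc] at h hdet
      simp at h
      simp [h] at hdet
    have hn : A 0 0 * z + A 0 1 ≠ 0 := by
      intro h0
      have : (A 0 0 * z + A 0 1) * A 1 0 - A 0 0 * (A 1 0 * z + A 1 1) = -1 := by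
        linear_combination -hdet
      rw [h, h0] at this
      simp at this
    rw [continuousAt_iff_punctured_nhds]
    have hne : ∀ᶠ w in 𝓝[≠] z, A 1 0 * w + A 1 1 ≠ 0 := by
      filter_upwards [self_mem_nhdsWithin] with w hw hw0
      exact hw (mul_left_cancel₀ hc (by linear_combination hw0 - h))
    have h1 : Tendsto (fun w : ℂ => A 1 0 * w + A 1 1) (𝓝[≠] z) (𝓝[≠] 0) := by
      refine tendsto_nhdsWithin_iff.2 ⟨?_, hne⟩
      have := hden.tendsto.mono_left (nhdsWithin_le_nhds (s := {z}ᶜ))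
      rwa [h] at this
    have h2 : Tendsto (fun w : ℂ => (A 0 0 * w + A 0 1) / (A 1 0 * w + A 1 1)) (𝓝[≠] z)
        (Bornology.cobounded ℂ) := by
      rw [← tendsto_norm_atTop_iff_cobounded]
      have h3 := tendsto_norm_cobounded_atTop.comp (tendsto_inv₀_nhdsNE_zero.comp h1)
      have h4 := (hnum.tendsto.mono_left (nhdsWithin_le_nhds (s := {z}ᶜ))).norm
      refine (h4.pos_mul_atTop (norm_pos_iff.2 hn) h3).congr fun w => ?_
      rw [Function.comp_apply, Function.comp_apply, ← norm_mul, div_eq_mul_inv]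
    rw [Metric.cobounded_eq_cocompact, ← coclosedCompact_eq_cocompact] at h2
    have h3 := (OnePoint.tendsto_coe_infty (X := ℂ)).comp h2
    simp only [Function.comp_apply, mk_smul_coe, if_pos h]
    refine h3.congr' ?_
    filter_upwards [hne] with w hw
    simp [mk_smul_coe, hw]
  · have h1 : ContinuousAt (fun w : ℂ =>
        (((A 0 0 * w + A 0 1) / (A 1 0 * w + A 1 1) : ℂ) : OnePoint ℂ)) z :=
      OnePoint.continuous_coe.continuousAt.comp (hnum.div hden h)
    refine h1.congr ?_
    filter_upwards [hden.eventually_ne h] with w hw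
    simp [mk_smul_coe, hw]

/-- The matrix of `z ↦ -1 / z`. -/
def invMatrix : SL(2, ℂ) := ⟨!![0, -1; 1, 0], by simp [Matrix.det_fin_two]⟩

theorem continuousAt_invMatrix_smul_infty :
    ContinuousAt (fun x : OnePoint ℂ => (QuotientGroup.mk invMatrix : PSL(2, ℂ)) • x) ∞ := by
  rw [OnePoint.continuousAt_infty', coclosedCompact_eq_cocompact, ← Metric.cobounded_eq_cocompact]
  have h0 : (QuotientGroup.mk invMatrix : PSL(2, ℂ)) • (∞ : OnePoint ℂ) = ((0 : ℂ) : OnePoint ℂ) := by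
    rw [mk_smul_infty]
    simp [invMatrix]
  have h1 := (OnePoint.continuous_coe (X := ℂ)).continuousAt.tendsto.comp
    ((tendsto_inv₀_cobounded (α := ℂ)).neg)
  rw [neg_zero] at h1
  simp only [h0]
  refine h1.congr' ?_
  filter_upwards [Bornology.isBounded_def.1 (Set.finite_singleton (0 : ℂ)).isBounded] with z hz
  have hz' : z ≠ 0 := hz
  simp only [Function.comp_apply]
  rw [mk_smul_coe]
  simp [invMatrix, hz', neg_div]

theorem continuous_smul (g : PSL(2, ℂ)) : Continuous fun x : OnePoint ℂ => g • x := by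
  rw [continuous_iff_continuousAt]
  have hcoe : ∀ (g : PSL(2, ℂ)) (z : ℂ),
      ContinuousAt (fun x : OnePoint ℂ => g • x) (z : OnePoint ℂ) := fun g z => by
    obtain ⟨A, rfl⟩ := QuotientGroup.mk_surjective g
    exact continuousAt_mk_smul_coe A z
  intro x
  cases x with
  | coe z => exact hcoe g z
  | infty =>
    set s : PSL(2, ℂ) := QuotientGroup.mk invMatrix with hs
    have h0 : s • (∞ : OnePoint ℂ) = ((0 : ℂ) : OnePoint ℂ) := by
      rw [hs, mk_smul_infty]
      simp [invMatrix]
    -- Factoring $g=(gs^{-1})s$ with $s\infty=0$ reduces continuity at $\infty$ to that of $s$ there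
    -- and of $gs^{-1}$ at a finite point.
    have h1 : ContinuousAt (fun x : OnePoint ℂ => (g * s⁻¹) • x) (s • (∞ : OnePoint ℂ)) := by
      rw [h0]
      exact hcoe _ 0
    have h2 := h1.comp (f := fun x : OnePoint ℂ => s • x) continuousAt_invMatrix_smul_infty
    refine h2.congr (Eventually.of_forall fun y => ?_)
    simp [mul_smul]

theorem isOpen_discontinuityRegion (Γ : Subgroup PSL(2, ℂ)) : IsOpen (discontinuityRegion Γ) := by
  rw [isOpen_iff_mem_nhds]
  rintro x ⟨V, hV, hx, hfin⟩
  exact mem_of_superset (hV.mem_nhds hx) fun y hy => ⟨V, hV, hy, hfin⟩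

theorem smul_mem_discontinuityRegion {Γ : Subgroup PSL(2, ℂ)} {γ : PSL(2, ℂ)} (hγ : γ ∈ Γ)
    {x : OnePoint ℂ} (hx : x ∈ discontinuityRegion Γ) : γ • x ∈ discontinuityRegion Γ := by
  obtain ⟨V, hV, hxV, hfin⟩ := hx
  refine ⟨(fun y => γ⁻¹ • y) ⁻¹' V, hV.preimage (continuous_smul _), by simpa using hxV, ?_⟩
  let γ' : Γ := ⟨γ, hγ⟩
  -- If $\delta$ moves $\gamma V$ to meet itself, then $\gamma^{-1}\delta\gamma$ does so for $V$;
  -- conjugation is injective, so finiteness transfers.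
  refine (hfin.preimage (f := fun δ : Γ => γ'⁻¹ * δ * γ')
    (fun a _ b _ h => by simpa using h)).subset ?_
  rintro δ ⟨_, ⟨y, hy, rfl⟩, hy'⟩
  refine ⟨γ⁻¹ • (δ : PSL(2, ℂ)) • y, ⟨γ⁻¹ • y, hy, ?_⟩, hy'⟩
  simp [γ', mul_smul]

theorem isOpen_affineRegion (Γ : Subgroup PSL(2, ℂ)) : IsOpen (affineRegion Γ) :=
  (isOpen_discontinuityRegion Γ).preimage OnePoint.continuous_coe

/-- If `∞` is a limit point, no point of the region of discontinuity is mapped to `∞`. -/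
theorem coe_mob {Γ : Subgroup PSL(2, ℂ)} (hΓ : ∞ ∈ limitSet Γ) {γ : PSL(2, ℂ)} (hγ : γ ∈ Γ)
    {z : ℂ} (hz : z ∈ affineRegion Γ) :
    ((mob γ z : ℂ) : OnePoint ℂ) = γ • (z : OnePoint ℂ) := by
  have h := smul_mem_discontinuityRegion hγ hz
  have hne : γ • (z : OnePoint ℂ) ≠ ∞ := fun h' => hΓ (h' ▸ h)
  obtain ⟨w, hw⟩ := OnePoint.ne_infty_iff_exists.1 hne
  rw [mob, ← hw]
  rfl

theorem mob_mem {Γ : Subgroup PSL(2, ℂ)} (hΓ : ∞ ∈ limitSet Γ) {γ : PSL(2, ℂ)} (hγ : γ ∈ Γ)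
    {z : ℂ} (hz : z ∈ affineRegion Γ) : mob γ z ∈ affineRegion Γ := by
  rw [affineRegion, mem_ofPred_eq, coe_mob hΓ hγ hz]
  exact smul_mem_discontinuityRegion hγ hz

/-! ### Derivatives of Möbius transformations. -/

/-- The automorphy factor `c z + d`. -/
def denom (A : SL(2, ℂ)) (z : ℂ) : ℂ := A 1 0 * z + A 1 1

theorem denom_ne_zero {Γ : Subgroup PSL(2, ℂ)} (hΓ : ∞ ∈ limitSet Γ) {A : SL(2, ℂ)}
    (hA : (QuotientGroup.mk A : PSL(2, ℂ)) ∈ Γ) {z : ℂ} (hz : z ∈ affineRegion Γ) :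
    denom A z ≠ 0 := by
  intro h
  have h1 := coe_mob hΓ hA hz
  rw [mk_smul_coe, if_pos (by exact h)] at h1
  exact OnePoint.coe_ne_infty _ h1

theorem mob_mk {A : SL(2, ℂ)} {z : ℂ} (h : denom A z ≠ 0) :
    mob (QuotientGroup.mk A) z = (A 0 0 * z + A 0 1) / denom A z := by
  rw [mob, mk_smul_coe, if_neg (by exact h)]
  rfl

theorem eventually_denom_ne_zero {A : SL(2, ℂ)} {z : ℂ} (h : denom A z ≠ 0) :
    ∀ᶠ w in 𝓝 z, denom A w ≠ 0 := by
  have : ContinuousAt (denom A) z := by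
    unfold denom
    fun_prop
  exact this.eventually_ne h

theorem hasDerivAt_denom (A : SL(2, ℂ)) (z : ℂ) : HasDerivAt (denom A) (A 1 0) z := by
  have h := ((hasDerivAt_id z).const_mul (A 1 0)).add_const (A 1 1)
  rw [mul_one] at h
  exact h

theorem hasDerivAt_mob {A : SL(2, ℂ)} {z : ℂ} (h : denom A z ≠ 0) :
    HasDerivAt (mob (QuotientGroup.mk A)) (1 / denom A z ^ 2) z := by
  have h1 : HasDerivAt (fun w => A 0 0 * w + A 0 1) (A 0 0) z := by
    simpa using ((hasDerivAt_id z).const_mul (A 0 0)).add_const (A 0 1)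
  refine ((h1.div (hasDerivAt_denom A z) h).congr_deriv ?_).congr_of_eventuallyEq ?_
  · rw [denom]
    congr 1
    linear_combination det_eq A
  · filter_upwards [eventually_denom_ne_zero h] with w hw
    exact mob_mk hw

theorem deriv_mob {A : SL(2, ℂ)} {z : ℂ} (h : denom A z ≠ 0) :
    deriv (mob (QuotientGroup.mk A)) z = 1 / denom A z ^ 2 := (hasDerivAt_mob h).deriv

theorem hasDerivAt_deriv_mob {A : SL(2, ℂ)} {z : ℂ} (h : denom A z ≠ 0) :
    HasDerivAt (deriv (mob (QuotientGroup.mk A))) (-2 * A 1 0 / denom A z ^ 3) z := by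
  have h1 : HasDerivAt (fun w => 1 / denom A w ^ 2) (-2 * A 1 0 / denom A z ^ 3) z := by
    simp only [one_div]
    refine (((hasDerivAt_denom A z).pow 2).inv (pow_ne_zero 2 h)).congr_deriv ?_
    simp only [Pi.pow_apply]
    field_simp
    ring
  refine h1.congr_of_eventuallyEq ?_
  filter_upwards [eventually_denom_ne_zero h] with w hw
  exact deriv_mob hw

theorem log_norm_deriv_mob {A : SL(2, ℂ)} {z : ℂ} (h : denom A z ≠ 0) :
    Real.log ‖deriv (mob (QuotientGroup.mk A)) z‖ = -2 * Real.log ‖denom A z‖ := by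
  rw [deriv_mob h, norm_div, norm_one, norm_pow, one_div, Real.log_inv, Real.log_pow]
  push_cast
  ring

/-- The logarithmic derivative `γ'' / γ'`. -/
def logDerivCoeff (A : SL(2, ℂ)) (z : ℂ) : ℂ := -2 * A 1 0 / denom A z

theorem dlog_deriv_mob {A : SL(2, ℂ)} {z : ℂ} (h : denom A z ≠ 0) :
    dlog (deriv (mob (QuotientGroup.mk A))) z =
      logDerivCoeff A z • ContinuousLinearMap.id ℝ ℂ := by
  rw [dlog, (hasDerivAt_deriv_mob h).deriv, deriv_mob h, logDerivCoeff]
  congr 1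
  field_simp

theorem hasDerivAt_logDerivCoeff {A : SL(2, ℂ)} {z : ℂ} (h : denom A z ≠ 0) :
    HasDerivAt (logDerivCoeff A) (2 * A 1 0 ^ 2 / denom A z ^ 2) z := by
  refine ((hasDerivAt_const z (-2 * A 1 0)).div (hasDerivAt_denom A z) h).congr_deriv ?_
  congr 1
  ring

/-- The real-linear functional `v ↦ Re (a v)`. -/
def reMul (a : ℂ) : ℂ →L[ℝ] ℝ := Complex.reCLM.comp (a • ContinuousLinearMap.id ℝ ℂ)

@[simp]
theorem reMul_apply (a v : ℂ) : reMul a v = (a * v).re := rfl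

theorem hasFDerivAt_log_norm_deriv_mob {A : SL(2, ℂ)} {z : ℂ} (h : denom A z ≠ 0) :
    HasFDerivAt (fun w => Real.log ‖deriv (mob (QuotientGroup.mk A)) w‖)
      (reMul (logDerivCoeff A z)) z := by
  have h1 := hasFDerivAt_log_norm (hasDerivAt_deriv_mob h)
    (by rw [deriv_mob h]; exact one_div_ne_zero (pow_ne_zero 2 h))
  refine h1.congr_fderiv ?_
  rw [reMul, logDerivCoeff, deriv_mob h]
  congr 2
  field_simp

/-! ### Calculus of forms on the plane. -/

/-- The differential of a real function is encoded by one complex number $q$; then $\partial$,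
$\bar\partial$ and $d^c$ are $\frac12q\,dz$, its conjugate and $i\operatorname{Im}(q\,dz)$. -/
theorem exists_eq_reMul (L : ℂ →L[ℝ] ℝ) : ∃ q : ℂ, L = reMul q := by
  refine ⟨L 1 - Complex.I * L Complex.I, ?_⟩
  ext1 v
  have h : v = v.re • (1 : ℂ) + v.im • Complex.I := by
    simp
  conv_lhs => rw [h, map_add, _root_.map_smul, _root_.map_smul]
  simp [mul_comm]

theorem reMul_injective {a b : ℂ} (h : ∀ v, (a * v).re = (b * v).re) : a = b := by
  have h1 := h 1
  have h2 := h Complex.I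
  simp at h1 h2
  exact Complex.ext h1 h2

theorem del_ofReal {φ : ℂ → ℝ} {q z : ℂ} (h : HasFDerivAt φ (reMul q) z) (v : ℂ) :
    del (fun w => (φ w : ℂ)) z v = q * v / 2 := by
  have h1 : HasFDerivAt (fun w => (φ w : ℂ)) (Complex.ofRealCLM.comp (reMul q)) z :=
    Complex.ofRealCLM.hasFDerivAt.comp z h
  rw [del, h1.fderiv]
  apply Complex.ext <;> simp <;> ring

theorem delbar_ofReal {φ : ℂ → ℝ} {q z : ℂ} (h : HasFDerivAt φ (reMul q) z) (v : ℂ) :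
    delbar (fun w => (φ w : ℂ)) z v = (starRingEnd ℂ) (q * v) / 2 := by
  have h1 : HasFDerivAt (fun w => (φ w : ℂ)) (Complex.ofRealCLM.comp (reMul q)) z :=
    Complex.ofRealCLM.hasFDerivAt.comp z h
  rw [delbar, h1.fderiv]
  apply Complex.ext <;> simp <;> ring

theorem dc_ofReal {φ : ℂ → ℝ} {q z : ℂ} (h : HasFDerivAt φ (reMul q) z) (v : ℂ) :
    dc (fun w => (φ w : ℂ)) z v = Complex.I * ((q * v).im : ℂ) := by
  rw [dc, sub_apply, del_ofReal h, delbar_ofReal h]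
  apply Complex.ext
  · simp
  · simp; ring

theorem pi1_apply (α : ℂ → ℂ →L[ℝ] ℂ) (z v : ℂ) :
    pi1 α z v = Complex.I * ((α z v).im : ℂ) := by
  rw [pi1]
  apply Complex.ext
  · simp
  · simp; ring

@[simp]
theorem form0_apply (f : ℂ → ℂ) (z : ℂ) (v : Fin 0 → ℂ) : form0 f z v = f z := rfl

@[simp]
theorem form1_apply (α : ℂ → ℂ →L[ℝ] ℂ) (z : ℂ) (v : Fin 1 → ℂ) :
    form1 α z v = α z (v 0) := rfl

theorem wedge_apply (α β : ℂ → ℂ →L[ℝ] ℂ) (z : ℂ) (v : Fin 2 → ℂ) :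
    wedge α β z v = α z (v 0) * β z (v 1) - α z (v 1) * β z (v 0) := by
  have h : (Finset.univ : Finset (Equiv.Perm (Fin 2))) = {1, Equiv.swap 0 1} := by decide
  simp only [wedge, ContinuousMultilinearMap.alternatization_apply_apply,
    ContinuousMultilinearMap.compContinuousLinearMap_apply]
  rw [h, Finset.sum_pair (by decide)]
  simp [Fin.prod_univ_two, sub_eq_add_neg]

theorem pullback_apply {p : ℕ} (γ : PSL(2, ℂ)) (ω : Form p) (z : ℂ) (v : Fin p → ℂ) :
    pullback γ ω z v = ω (mob γ z) (fderiv ℝ (mob γ) z ∘ v) := rfl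

theorem extDeriv_form0_apply (f : ℂ → ℂ) (z : ℂ) (v : Fin 1 → ℂ) :
    extDeriv (form0 f) z v = fderiv ℝ f z (v 0) := by
  unfold form0
  rw [extDeriv_constOfIsEmpty]
  rfl

/-- The isometry between functionals and alternating forms of degree one. -/
def functionalEquivForm : (ℂ →L[ℝ] ℂ) ≃ₗᵢ[ℝ] ℂ [⋀^Fin 1]→L[ℝ] ℂ :=
  ContinuousAlternatingMap.ofSubsingletonLIE 0

theorem extDeriv_form1_apply {α : ℂ → ℂ →L[ℝ] ℂ} {z : ℂ} {α' : ℂ →L[ℝ] ℂ →L[ℝ] ℂ}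
    (h : HasFDerivAt α α' z) (v : Fin 2 → ℂ) :
    extDeriv (form1 α) z v = α' (v 0) (v 1) - α' (v 1) (v 0) := by
  have h1 : HasFDerivAt (form1 α)
      ((functionalEquivForm.toContinuousLinearEquiv : (ℂ →L[ℝ] ℂ) →L[ℝ] _).comp α') z :=
    functionalEquivForm.toContinuousLinearEquiv.hasFDerivAt.comp z h
  rw [extDeriv, h1.fderiv, ContinuousAlternatingMap.alternatizeUncurryFin_apply,
    Fin.sum_univ_two]
  simp only [Fin.val_zero, pow_zero, one_smul, Fin.val_one, pow_one, neg_smul]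
  rw [sub_eq_add_neg]
  rfl

theorem three_form_eq_zero (ω : ℂ [⋀^Fin 3]→L[ℝ] ℂ) : ω = 0 := by
  ext v
  refine ω.toAlternatingMap.map_linearDependent v fun h => ?_
  have := h.fintype_card_le_finrank
  simp [Complex.finrank_real_complex] at this

theorem contDiffOn_form0 {f : ℂ → ℂ} {U : Set ℂ}
    (h : ContDiffOn ℝ ((⊤ : ℕ∞) : WithTop ℕ∞) f U) :
    ContDiffOn ℝ ((⊤ : ℕ∞) : WithTop ℕ∞) (form0 f) U :=
  (ContinuousAlternatingMap.constOfIsEmptyLIE ℝ ℂ ℂ (Fin 0)).contDiff.comp_contDiffOn h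

theorem contDiffOn_form1 {α : ℂ → ℂ →L[ℝ] ℂ} {U : Set ℂ}
    (h : ContDiffOn ℝ ((⊤ : ℕ∞) : WithTop ℕ∞) α U) :
    ContDiffOn ℝ ((⊤ : ℕ∞) : WithTop ℕ∞) (form1 α) U :=
  functionalEquivForm.contDiff.comp_contDiffOn h

theorem contDiffOn_wedge {α β : ℂ → ℂ →L[ℝ] ℂ} {U : Set ℂ}
    (hα : ContDiffOn ℝ ((⊤ : ℕ∞) : WithTop ℕ∞) α U)
    (hβ : ContDiffOn ℝ ((⊤ : ℕ∞) : WithTop ℕ∞) β U) :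
    ContDiffOn ℝ ((⊤ : ℕ∞) : WithTop ℕ∞) (wedge α β) U := by
  -- A 2-form on the plane is determined by its value on $(1,i)$, so smoothness reduces to that of
  -- the scalar coefficient of $dx\wedge dy$.
  have h : wedge α β = fun z => (α z 1 * β z Complex.I - α z Complex.I * β z 1) •
      wedge (fun _ => Complex.ofRealCLM.comp Complex.reCLM)
        (fun _ => Complex.ofRealCLM.comp Complex.imCLM) 0 := by
    funext z
    ext v
    have e : ∀ (L : ℂ →L[ℝ] ℂ) (v : ℂ), L v = v.re * L 1 + v.im * L Complex.I := fun L v => by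
      have h : v = v.re • (1 : ℂ) + v.im • Complex.I := by simp
      conv_lhs => rw [h, map_add, _root_.map_smul, _root_.map_smul]
      simp
    rw [ContinuousAlternatingMap.smul_apply, wedge_apply, wedge_apply, e (α z) (v 0),
      e (α z) (v 1), e (β z) (v 0), e (β z) (v 1)]
    simp
    ring
  rw [h]
  have hα' : ∀ v, ContDiffOn ℝ ((⊤ : ℕ∞) : WithTop ℕ∞) (fun z => α z v) U :=
    fun v => hα.clm_apply contDiffOn_const
  have hβ' : ∀ v, ContDiffOn ℝ ((⊤ : ℕ∞) : WithTop ℕ∞) (fun z => β z v) U :=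
    fun v => hβ.clm_apply contDiffOn_const
  exact (((hα' _).mul (hβ' _)).sub ((hα' _).mul (hβ' _))).smul contDiffOn_const

theorem contDiffOn_del {f : ℂ → ℂ} {U : Set ℂ} (hU : IsOpen U)
    (h : ContDiffOn ℝ ((⊤ : ℕ∞) : WithTop ℕ∞) f U) :
    ContDiffOn ℝ ((⊤ : ℕ∞) : WithTop ℕ∞) (del f) U := by
  have h1 := ((contDiffOn_infty_iff_fderiv_of_isOpen hU).1 h).2
  unfold del
  exact contDiffOn_const.fun_smul (h1.sub (contDiffOn_const.fun_smul
    (h1.clm_comp contDiffOn_const)))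

theorem contDiffOn_delbar {f : ℂ → ℂ} {U : Set ℂ} (hU : IsOpen U)
    (h : ContDiffOn ℝ ((⊤ : ℕ∞) : WithTop ℕ∞) f U) :
    ContDiffOn ℝ ((⊤ : ℕ∞) : WithTop ℕ∞) (delbar f) U := by
  have h1 := ((contDiffOn_infty_iff_fderiv_of_isOpen hU).1 h).2
  unfold delbar
  exact contDiffOn_const.fun_smul (h1.add (contDiffOn_const.fun_smul
    (h1.clm_comp contDiffOn_const)))

/-- `a ↦ (v ↦ Im (a v))` as a continuous linear map. -/
def imMulCLM : ℂ →L[ℝ] ℂ →L[ℝ] ℝ :=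
  LinearMap.toContinuousLinearMap
    { toFun := imMul
      map_add' := fun a b => by ext1 v; simp [add_mul]
      map_smul' := fun r a => by ext1 v; simp [mul_assoc] }

theorem imMulCLM_apply (a : ℂ) : imMulCLM a = imMul a := rfl

/-- Post-composition with `t ↦ √-1 t`. -/
def imaginaryCLM : (ℂ →L[ℝ] ℝ) →L[ℝ] ℂ →L[ℝ] ℂ :=
  ContinuousLinearMap.compL ℝ ℂ ℝ ℂ (Complex.I • Complex.ofRealCLM)

@[simp]
theorem imaginaryCLM_apply (L : ℂ →L[ℝ] ℝ) (v : ℂ) :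
    imaginaryCLM L v = Complex.I * (L v : ℂ) := by
  simp [imaginaryCLM]

/-! ### The identity $d\omega^1_\gamma=\gamma^*\omega^0-\omega^0$. -/

/-- The coefficient `log ρ - log |γ'| + log |c_γ|`. -/
def omegaCoeff (ρ : ℂ → ℝ) (A : SL(2, ℂ)) (z : ℂ) : ℝ :=
  Real.log (ρ z) - Real.log ‖deriv (mob (QuotientGroup.mk A)) z‖ - 2 * Real.log ‖A 1 0‖

/-- The functional `√-1 (log ρ - log |γ'| + log |c_γ|) Im (d log γ')`. -/
def omegaFunctional (ρ : ℂ → ℝ) (A : SL(2, ℂ)) (z : ℂ) : ℂ →L[ℝ] ℂ :=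
  imaginaryCLM (omegaCoeff ρ A z • imMulCLM (logDerivCoeff A z))

theorem omegaFunctional_apply (ρ : ℂ → ℝ) (A : SL(2, ℂ)) (z v : ℂ) :
    omegaFunctional ρ A z v =
      Complex.I * (omegaCoeff ρ A z * (logDerivCoeff A z * v).im : ℝ) := by
  rw [omegaFunctional, imaginaryCLM_apply, smul_apply, imMulCLM_apply, imMul_apply, smul_eq_mul]

theorem hasFDerivAt_smul_id {f : ℂ → ℂ} {f' z : ℂ} (h : HasDerivAt f f' z) :
    HasFDerivAt f (f' • ContinuousLinearMap.id ℝ ℂ) z := by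
  refine (h.hasFDerivAt.restrictScalars ℝ).congr_fderiv ?_
  ext
  all_goals simp [mul_comm]

section Region

variable {Γ : Subgroup PSL(2, ℂ)} {ρ : ℂ → ℝ}

theorem log_automorphic (hΓ : ∞ ∈ limitSet Γ) (hρ : IsConformalMetric Γ ρ) {A : SL(2, ℂ)}
    (hA : (QuotientGroup.mk A : PSL(2, ℂ)) ∈ Γ) {z : ℂ} (hz : z ∈ affineRegion Γ) :
    Real.log (ρ (mob (QuotientGroup.mk A) z)) =
      Real.log (ρ z) - 2 * Real.log ‖deriv (mob (QuotientGroup.mk A)) z‖ := by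
  have hd : ‖deriv (mob (QuotientGroup.mk A)) z‖ ≠ 0 := by
    rw [deriv_mob (denom_ne_zero hΓ hA hz), norm_ne_zero_iff]
    exact one_div_ne_zero (pow_ne_zero 2 (denom_ne_zero hΓ hA hz))
  rw [← hρ.automorphic _ hA z hz, Real.log_mul (hρ.pos _ (mob_mem hΓ hA hz)).ne'
    (pow_ne_zero 2 hd), Real.log_pow]
  push_cast
  ring

/-- Automorphy eliminates $\rho\circ\gamma$. Since $d^c\log|\gamma'|$ and $\pi_1\,d\log\gamma'$ are
both $i\operatorname{Im}(h\,dz)$, $\kappa_\gamma$ only shifts the coefficient. -/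
theorem omega1_eqOn (hΓ : ∞ ∈ limitSet Γ) (hρ : IsConformalMetric Γ ρ) {A : SL(2, ℂ)}
    (hA : (QuotientGroup.mk A : PSL(2, ℂ)) ∈ Γ) :
    EqOn (omega1 ρ (QuotientGroup.mk A)) (form1 (omegaFunctional ρ A)) (affineRegion Γ) := by
  intro z hz
  have hd := denom_ne_zero hΓ hA hz
  ext v
  have h1 : cCoeff (QuotientGroup.mk A) = 1 / (A 1 0) ^ 2 := rfl
  -- For $c=0$ this still holds, both sides being $0$ by the conventions for division and logarithm.
  have h2 : Real.log ‖cCoeff (QuotientGroup.mk A)‖ = -(2 * Real.log ‖A 1 0‖) := by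
    rw [h1, norm_div, norm_one, norm_pow, one_div, Real.log_inv, Real.log_pow]
    push_cast
    rfl
  rw [omega1, kappa, Pi.add_apply, ContinuousAlternatingMap.add_apply, form1_apply, form1_apply,
    form1_apply, smul_apply, smul_apply, dc_ofReal (hasFDerivAt_log_norm_deriv_mob hd), pi1_apply,
    dlog_deriv_mob hd, omegaFunctional_apply, h2, log_automorphic hΓ hρ hA hz, omegaCoeff]
  simp only [smul_apply, ContinuousLinearMap.id_apply, smul_eq_mul]
  push_cast
  ring

theorem contDiffOn_log_metric (hρ : IsConformalMetric Γ ρ) :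
    ContDiffOn ℝ ((⊤ : ℕ∞) : WithTop ℕ∞) (fun z => Real.log (ρ z)) (affineRegion Γ) :=
  hρ.smooth.log fun z hz => (hρ.pos z hz).ne'

theorem exists_hasFDerivAt_log_metric (hρ : IsConformalMetric Γ ρ) {z : ℂ}
    (hz : z ∈ affineRegion Γ) :
    ∃ q : ℂ, HasFDerivAt (fun z => Real.log (ρ z)) (reMul q) z := by
  have h := ((contDiffOn_log_metric hρ).differentiableOn (by simp)).differentiableAt
    ((isOpen_affineRegion Γ).mem_nhds hz)
  obtain ⟨q, hq⟩ := exists_eq_reMul (fderiv ℝ (fun z => Real.log (ρ z)) z)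
  exact ⟨q, hq ▸ h.hasFDerivAt⟩

theorem contDiff_denom (A : SL(2, ℂ)) : ContDiff ℝ ((⊤ : ℕ∞) : WithTop ℕ∞) (denom A) :=
  (contDiff_const.mul contDiff_id).add contDiff_const

theorem contDiffOn_omegaFunctional (hΓ : ∞ ∈ limitSet Γ) (hρ : IsConformalMetric Γ ρ)
    {A : SL(2, ℂ)} (hA : (QuotientGroup.mk A : PSL(2, ℂ)) ∈ Γ) :
    ContDiffOn ℝ ((⊤ : ℕ∞) : WithTop ℕ∞) (omegaFunctional ρ A) (affineRegion Γ) := by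
  have hd : ∀ z ∈ affineRegion Γ, denom A z ≠ 0 := fun z hz => denom_ne_zero hΓ hA hz
  have h1 : ContDiffOn ℝ ((⊤ : ℕ∞) : WithTop ℕ∞)
      (fun z => Real.log ‖deriv (mob (QuotientGroup.mk A)) z‖) (affineRegion Γ) := by
    have h2 : ContDiffOn ℝ ((⊤ : ℕ∞) : WithTop ℕ∞) (fun z => -2 * Real.log ‖denom A z‖)
        (affineRegion Γ) :=
      contDiffOn_const.mul (((contDiff_denom A).contDiffOn.norm ℝ hd).log
        fun z hz => norm_ne_zero_iff.2 (hd z hz))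
    exact h2.congr fun z hz => log_norm_deriv_mob (hd z hz)
  have h2 : ContDiffOn ℝ ((⊤ : ℕ∞) : WithTop ℕ∞) (logDerivCoeff A) (affineRegion Γ) :=
    (contDiffOn_const.mul ((contDiff_denom A).contDiffOn.inv hd)).congr
      fun z _ => div_eq_mul_inv _ _
  have h3 : ContDiffOn ℝ ((⊤ : ℕ∞) : WithTop ℕ∞) (omegaCoeff ρ A) (affineRegion Γ) :=
    ((contDiffOn_log_metric hρ).sub h1).sub contDiffOn_const
  exact imaginaryCLM.contDiff.comp_contDiffOn
    (h3.smul (imMulCLM.contDiff.comp_contDiffOn h2))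

/-- Since $\gamma''/\gamma'$ is holomorphic, its contribution to the second derivative is symmetric
in the two vectors and cancels. Only the differential of the coefficient survives. -/
theorem extDeriv_omega1_apply (hΓ : ∞ ∈ limitSet Γ) (hρ : IsConformalMetric Γ ρ) {A : SL(2, ℂ)}
    (hA : (QuotientGroup.mk A : PSL(2, ℂ)) ∈ Γ) {z q : ℂ} (hz : z ∈ affineRegion Γ)
    (hq : HasFDerivAt (fun z => Real.log (ρ z)) (reMul q) z) (v : Fin 2 → ℂ) :
    extDeriv (omega1 ρ (QuotientGroup.mk A)) z v =
      Complex.I * ((((q - logDerivCoeff A z) * v 0).re * (logDerivCoeff A z * v 1).im -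
        ((q - logDerivCoeff A z) * v 1).re * (logDerivCoeff A z * v 0).im : ℝ) : ℂ) := by
  have hd := denom_ne_zero hΓ hA hz
  rw [((omega1_eqOn hΓ hρ hA).eventuallyEq_of_mem
    ((isOpen_affineRegion Γ).mem_nhds hz)).extDeriv_eq]
  have h1 : HasFDerivAt (omegaCoeff ρ A) (reMul q - reMul (logDerivCoeff A z)) z :=
    (hq.sub (hasFDerivAt_log_norm_deriv_mob hd)).sub_const _
  have h2 := imMulCLM.hasFDerivAt.comp z (hasFDerivAt_smul_id (hasDerivAt_logDerivCoeff hd))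
  have h3 : HasFDerivAt (omegaFunctional ρ A) _ z :=
    imaginaryCLM.hasFDerivAt.comp z (h1.fun_smul h2)
  rw [extDeriv_form1_apply h3]
  simp only [ContinuousLinearMap.comp_apply, imaginaryCLM_apply, add_apply, smul_apply,
    ContinuousLinearMap.smulRight_apply, sub_apply, reMul_apply, imMulCLM_apply, imMul_apply,
    ContinuousLinearMap.id_apply, Function.comp_apply, smul_eq_mul, sub_mul, Complex.sub_re]
  rw [← mul_sub, ← Complex.ofReal_sub]
  congr 2
  rw [mul_right_comm _ (v 1) (v 0)]
  ring

theorem omega0_apply {z q : ℂ} (hq : HasFDerivAt (fun z => Real.log (ρ z)) (reMul q) z)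
    (v : Fin 2 → ℂ) :
    omega0 ρ z v =
      Complex.I * ((1 / 4 * Complex.normSq q * (v 0 * (starRingEnd ℂ) (v 1)).im : ℝ) : ℂ) := by
  rw [omega0, ContinuousAlternatingMap.smul_apply, wedge_apply, del_ofReal hq, del_ofReal hq,
    delbar_ofReal hq, delbar_ofReal hq, Complex.normSq_apply]
  apply Complex.ext
  · simp
    ring
  · simp
    ring

theorem fderiv_mob_apply {A : SL(2, ℂ)} {z : ℂ} (h : denom A z ≠ 0) (v : ℂ) :
    fderiv ℝ (mob (QuotientGroup.mk A)) z v = deriv (mob (QuotientGroup.mk A)) z * v := by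
  rw [(hasFDerivAt_smul_id (hasDerivAt_mob h)).fderiv, deriv_mob h]
  rfl

/-- Two computations of the differential of $\log\rho\circ\gamma$, by the chain rule and by
automorphy, are compared. -/
theorem log_metric_deriv_mob (hΓ : ∞ ∈ limitSet Γ) (hρ : IsConformalMetric Γ ρ) {A : SL(2, ℂ)}
    (hA : (QuotientGroup.mk A : PSL(2, ℂ)) ∈ Γ) {z q q' : ℂ} (hz : z ∈ affineRegion Γ)
    (hq : HasFDerivAt (fun z => Real.log (ρ z)) (reMul q) z)
    (hq' : HasFDerivAt (fun z => Real.log (ρ z)) (reMul q') (mob (QuotientGroup.mk A) z)) :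
    q' * deriv (mob (QuotientGroup.mk A)) z = q - 2 * logDerivCoeff A z := by
  have hd := denom_ne_zero hΓ hA hz
  have h1 := hq'.comp z (hasFDerivAt_smul_id (hasDerivAt_mob hd).differentiableAt.hasDerivAt)
  have h2 := hq.sub ((hasFDerivAt_log_norm_deriv_mob hd).const_mul 2)
  have h3 := h2.congr_of_eventuallyEq (f₁ := (fun z => Real.log (ρ z)) ∘ mob (QuotientGroup.mk A))
    (by
      filter_upwards [(isOpen_affineRegion Γ).mem_nhds hz] with w hw
      exact log_automorphic hΓ hρ hA hw)
  have h4 := h1.unique h3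
  refine reMul_injective fun v => ?_
  have h5 := DFunLike.congr_fun h4 v
  simp only [ContinuousLinearMap.comp_apply, reMul_apply, ContinuousLinearMap.id_apply, sub_apply,
    smul_apply, smul_eq_mul] at h5
  rw [mul_assoc, h5, sub_mul, Complex.sub_re, mul_assoc]
  simp

/-- `d ω¹ = γ^* ω⁰ - ω⁰`. -/
theorem extDeriv_omega1 (hΓ : ∞ ∈ limitSet Γ) (hρ : IsConformalMetric Γ ρ) {γ : PSL(2, ℂ)}
    (hγ : γ ∈ Γ) {z : ℂ} (hz : z ∈ affineRegion Γ) :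
    extDeriv (omega1 ρ γ) z = pullback γ (omega0 ρ) z - omega0 ρ z := by
  obtain ⟨A, rfl⟩ := QuotientGroup.mk_surjective γ
  have hd := denom_ne_zero hΓ hγ hz
  obtain ⟨q, hq⟩ := exists_hasFDerivAt_log_metric hρ hz
  obtain ⟨q', hq'⟩ := exists_hasFDerivAt_log_metric hρ (mob_mem hΓ hγ hz)
  have hqq := log_metric_deriv_mob hΓ hρ hγ hz hq hq'
  ext v
  rw [extDeriv_omega1_apply hΓ hρ hγ hz hq, ContinuousAlternatingMap.sub_apply, pullback_apply,
    omega0_apply hq, omega0_apply hq', ← mul_sub, ← Complex.ofReal_sub]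
  congr 2
  simp only [Function.comp_apply, fderiv_mob_apply hd]
  set m := deriv (mob (QuotientGroup.mk A)) z
  set h := logDerivCoeff A z
  -- Pull-back multiplies the area form by $|\gamma'|^2$, which combines with $|q'|^2$ into
  -- $|q-2h|^2$.
  have e : Complex.normSq q' * (m * v 0 * (starRingEnd ℂ) (m * v 1)).im =
      Complex.normSq (q - 2 * h) * (v 0 * (starRingEnd ℂ) (v 1)).im := by
    rw [← hqq, map_mul]
    simp only [Complex.normSq_apply, map_mul, Complex.mul_im, Complex.mul_re, Complex.conj_re,
      Complex.conj_im]
    ring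
  rw [mul_assoc, e]
  simp only [Complex.normSq_apply, Complex.mul_im, Complex.mul_re, Complex.conj_re,
      Complex.conj_im, Complex.sub_re, Complex.sub_im]
  simp
  ring

end Region

/-! ### The differential and the coboundary of $\hat\omega^2$. -/

theorem crossDilog_eq_zero₃₄ (a b c : OnePoint ℂ) : crossDilog a b c c = 0 := by
  linarith [crossDilog_swap₃₄ a b c c]

theorem crossDilog_eq_zero₂₃ (a b d : OnePoint ℂ) : crossDilog a b b d = 0 := by
  linarith [crossDilog_swap₂₃ a b b d]

theorem crossDilog_eq_zero₂₄ (a b c : OnePoint ℂ) : crossDilog a b c b = 0 := by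
  rw [crossDilog_swap₃₄, crossDilog_eq_zero₂₃, neg_zero]

theorem omega2_eq (γ₁ γ₂ : PSL(2, ℂ)) : omega2 γ₁ γ₂ = form0 fun z => Complex.I *
    ((-4 * crossDilog z ((γ₁ * γ₂)⁻¹ • (∞ : OnePoint ℂ)) (γ₂⁻¹ • (∞ : OnePoint ℂ)) ∞ : ℝ) : ℂ) := by
  unfold omega2
  congr 1
  funext z
  rw [T, L2_crossRatio]
  push_cast
  ring

theorem mk_inv_smul_infty (A : SL(2, ℂ)) :
    (QuotientGroup.mk A : PSL(2, ℂ))⁻¹ • (∞ : OnePoint ℂ) =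
      if A 1 0 = 0 then ∞ else ((-A 1 1 / A 1 0 : ℂ) : OnePoint ℂ) := by
  rw [← QuotientGroup.mk_inv, mk_smul_infty, Matrix.SpecialLinearGroup.SL2_inv_expl]
  simp [div_neg, neg_div]

theorem sub_pole {A : SL(2, ℂ)} (h : A 1 0 ≠ 0) (z : ℂ) :
    z - -A 1 1 / A 1 0 = denom A z / A 1 0 := by
  rw [denom]
  field_simp
  ring

theorem denom_mul {A B : SL(2, ℂ)} {z : ℂ} (h : denom B z ≠ 0) :
    denom (A * B) z = denom A (mob (QuotientGroup.mk B) z) * denom B z := by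
  rw [mob_mk h, denom, denom]
  have e0 : (A * B) 1 0 = A 1 0 * B 0 0 + A 1 1 * B 1 0 := by
    simp [Matrix.mul_apply, Fin.sum_univ_two]
  have e1 : (A * B) 1 1 = A 1 0 * B 0 1 + A 1 1 * B 1 1 := by
    simp [Matrix.mul_apply, Fin.sum_univ_two]
  rw [e0, e1]
  field_simp
  rw [denom]
  ring

/-- When both poles are finite, this says that the poles of $AB$ and $B$ differ by
$c_A/(c_{AB}c_B)$. It is where $\log|c_A|$ enters the differential of $D_2\circ T_{12}$. -/
theorem entry_mul_denom (A B : SL(2, ℂ)) (z : ℂ) :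
    (A * B) 1 0 * denom B z - B 1 0 * denom (A * B) z = A 1 0 := by
  have e0 : (A * B) 1 0 = A 1 0 * B 0 0 + A 1 1 * B 1 0 := by
    simp [Matrix.mul_apply, Fin.sum_univ_two]
  have e1 : (A * B) 1 1 = A 1 0 * B 0 1 + A 1 1 * B 1 1 := by
    simp [Matrix.mul_apply, Fin.sum_univ_two]
  rw [denom, denom, e0, e1]
  linear_combination A 1 0 * det_eq B

/-- The derivative of the dilogarithm of the cross-ratio of a moving point, two poles and `∞`. -/
theorem hasFDerivAt_crossDilog_poles {A B : SL(2, ℂ)} {z : ℂ} (hB : denom B z ≠ 0)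
    (hAB : denom (A * B) z ≠ 0) :
    HasFDerivAt (fun w : ℂ => crossDilog w
        ((QuotientGroup.mk A * QuotientGroup.mk B : PSL(2, ℂ))⁻¹ • (∞ : OnePoint ℂ))
        ((QuotientGroup.mk B : PSL(2, ℂ))⁻¹ • (∞ : OnePoint ℂ)) ∞)
      ((Real.log ‖(A * B) 1 0‖ + Real.log ‖denom B z‖ - Real.log ‖A 1 0‖) •
          imMul ((A * B) 1 0 / denom (A * B) z) -
        (Real.log ‖denom (A * B) z‖ + Real.log ‖B 1 0‖ - Real.log ‖A 1 0‖) •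
          imMul (B 1 0 / denom B z)) z := by
  have key := entry_mul_denom A B z
  rw [← QuotientGroup.mk_mul, mk_inv_smul_infty, mk_inv_smul_infty]
  have hB' := norm_ne_zero_iff.2 hB
  have hAB' := norm_ne_zero_iff.2 hAB
  have hzero : imMul 0 = 0 := by
    ext1 v
    simp
  -- If one of $B$, $AB$, $A$ fixes $\infty$, two of the four points coincide and the function is
  -- zero. The identity `key` then loses a term, and the claimed differential vanishes as well.
  by_cases hb : B 1 0 = 0
  · simp only [hb, if_true, crossDilog_eq_zero₃₄]
    refine (hasFDerivAt_const (0 : ℝ) z).congr_fderiv ?_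
    rw [hb, zero_mul, sub_zero] at key
    by_cases hab : (A * B) 1 0 = 0
    · rw [hab, zero_div, zero_div, hzero]
      simp
    · rw [← key, norm_mul, Real.log_mul (norm_ne_zero_iff.2 hab) hB', zero_div, hzero]
      simp
  by_cases hab : (A * B) 1 0 = 0
  · simp only [hab, if_true, crossDilog_eq_zero₂₄]
    refine (hasFDerivAt_const (0 : ℝ) z).congr_fderiv ?_
    rw [hab, zero_mul, zero_sub] at key
    rw [← key, norm_neg, norm_mul, Real.log_mul (norm_ne_zero_iff.2 hb) hAB', zero_div, hzero,
      add_comm (Real.log ‖B 1 0‖)]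
    simp
  simp only [hb, hab, if_false]
  have hb' := norm_ne_zero_iff.2 hb
  have hab' := norm_ne_zero_iff.2 hab
  by_cases ha : A 1 0 = 0
  · rw [ha, sub_eq_zero] at key
    have e1 : -(A * B) 1 1 / (A * B) 1 0 = -B 1 1 / B 1 0 := by
      have h1 := sub_pole hab z
      have h2 := sub_pole hb z
      have h3 : denom (A * B) z / (A * B) 1 0 = denom B z / B 1 0 := by
        rw [div_eq_div_iff hab hb]
        linear_combination -key
      rw [h3, ← h2] at h1
      exact sub_right_injective h1
    have e2 : (A * B) 1 0 / denom (A * B) z = B 1 0 / denom B z := by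
      rw [div_eq_div_iff hAB hB]
      exact key
    have e3 : Real.log ‖(A * B) 1 0‖ + Real.log ‖denom B z‖ =
        Real.log ‖denom (A * B) z‖ + Real.log ‖B 1 0‖ := by
      rw [← Real.log_mul hab' hB', ← Real.log_mul hAB' hb', ← norm_mul, ← norm_mul, key, mul_comm]
    simp only [e1, crossDilog_eq_zero₂₃]
    refine (hasFDerivAt_const (0 : ℝ) z).congr_fderiv ?_
    rw [e2, e3, sub_self]
  have s1 := sub_pole hab z
  have s2 := sub_pole hb z
  set p := -(A * B) 1 1 / (A * B) 1 0
  set q := -B 1 1 / B 1 0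
  have s3 : p - q = A 1 0 / ((A * B) 1 0 * B 1 0) := by
    have : p - q = (z - q) - (z - p) := by ring
    rw [this, s1, s2, ← key]
    field_simp
  have hp : z ≠ p := by
    rw [← sub_ne_zero, s1]
    exact div_ne_zero hAB hab
  have hq : z ≠ q := by
    rw [← sub_ne_zero, s2]
    exact div_ne_zero hB hb
  have hpq : p ≠ q := by
    rw [← sub_ne_zero, s3]
    exact div_ne_zero ha (mul_ne_zero hab hb)
  have h1 := hasFDerivAt_blochWignerC_div hp hq hpq
  rw [s1, s2, s3, norm_div, norm_div, norm_div,
    norm_mul, Real.log_div hAB' hab', Real.log_div hB' hb',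
    Real.log_div (norm_ne_zero_iff.2 ha) (mul_ne_zero hab' hb'), Real.log_mul hab' hb',
    one_div_div, one_div_div] at h1
  refine (h1.congr_of_eventuallyEq ?_).congr_fderiv ?_
  · filter_upwards [eventually_ne_nhds hq] with w hw
    exact crossDilog_coe_infty hw
  · ext1 v
    simp only [add_apply, sub_apply, neg_apply, smul_apply, smul_eq_mul]
    ring

section Region

variable {Γ : Subgroup PSL(2, ℂ)} {ρ : ℂ → ℝ}

/-- `d ω² = δ ω¹`. -/
theorem extDeriv_omega2 (hΓ : ∞ ∈ limitSet Γ) (hρ : IsConformalMetric Γ ρ) {γ₁ γ₂ : PSL(2, ℂ)}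
    (h₁ : γ₁ ∈ Γ) (h₂ : γ₂ ∈ Γ) {z : ℂ} (hz : z ∈ affineRegion Γ) :
    extDeriv (omega2 γ₁ γ₂) z =
      omega1 ρ γ₂ z - omega1 ρ (γ₁ * γ₂) z + pullback γ₂ (omega1 ρ γ₁) z := by
  obtain ⟨A, rfl⟩ := QuotientGroup.mk_surjective γ₁
  obtain ⟨B, rfl⟩ := QuotientGroup.mk_surjective γ₂
  have h₁₂ : (QuotientGroup.mk (A * B) : PSL(2, ℂ)) ∈ Γ := Γ.mul_mem h₁ h₂
  have hB := denom_ne_zero hΓ h₂ hz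
  have hAB := denom_ne_zero hΓ h₁₂ hz
  have hA := denom_ne_zero hΓ h₁ (mob_mem hΓ h₂ hz)
  have hmul := denom_mul (A := A) hB
  ext v
  have hd : HasFDerivAt (fun w : ℂ => Complex.I * ((-4 * crossDilog w
      ((QuotientGroup.mk A * QuotientGroup.mk B : PSL(2, ℂ))⁻¹ • (∞ : OnePoint ℂ))
      ((QuotientGroup.mk B : PSL(2, ℂ))⁻¹ • (∞ : OnePoint ℂ)) ∞ : ℝ) : ℂ)) _ z :=
    (Complex.ofRealCLM.hasFDerivAt.comp z
      ((hasFDerivAt_crossDilog_poles hB hAB).const_mul (-4))).const_mul Complex.I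
  rw [omega2_eq, extDeriv_form0_apply, hd.fderiv, ContinuousAlternatingMap.add_apply,
    ContinuousAlternatingMap.sub_apply, pullback_apply, omega1_eqOn hΓ hρ h₁ (mob_mem hΓ h₂ hz),
    omega1_eqOn hΓ hρ h₂ hz, ← QuotientGroup.mk_mul, omega1_eqOn hΓ hρ h₁₂ hz, form1_apply,
    form1_apply, form1_apply, omegaFunctional_apply, omegaFunctional_apply, omegaFunctional_apply,
    Function.comp_apply, fderiv_mob_apply hB, smul_apply, ContinuousLinearMap.comp_apply,
    smul_eq_mul, ← mul_sub, ← mul_add, ← Complex.ofReal_sub, ← Complex.ofReal_add,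
    Complex.ofRealCLM_apply]
  congr 2
  have hlog : Real.log ‖denom A (mob (QuotientGroup.mk B) z)‖ =
      Real.log ‖denom (A * B) z‖ - Real.log ‖denom B z‖ := by
    rw [hmul, norm_mul, Real.log_mul (norm_ne_zero_iff.2 hA) (norm_ne_zero_iff.2 hB)]
    ring
  -- The chain rule in logarithmic form:
  -- $\gamma_2^*\,d\log\gamma_1'=d\log(\gamma_1\gamma_2)'-d\log\gamma_2'$. It also makes the
  -- coefficients of $\log\rho$ cancel.
  have hpull : logDerivCoeff A (mob (QuotientGroup.mk B) z) *
      (deriv (mob (QuotientGroup.mk B)) z * v 0) =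
      logDerivCoeff (A * B) z * v 0 - logDerivCoeff B z * v 0 := by
    rw [deriv_mob hB, logDerivCoeff, logDerivCoeff, logDerivCoeff, hmul,
      ← entry_mul_denom A B z, hmul]
    field_simp
    ring
  have hh : ∀ C : SL(2, ℂ), (logDerivCoeff C z * v 0).im =
      -2 * (C 1 0 / denom C z * v 0).im := fun C => by
    rw [logDerivCoeff, mul_div_assoc, mul_assoc]
    simp
  simp only [omegaCoeff]
  rw [hpull, Complex.sub_im, hh, hh, log_automorphic hΓ hρ h₂ hz, log_norm_deriv_mob hB,
    log_norm_deriv_mob hAB, log_norm_deriv_mob hA, hlog]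
  simp only [smul_apply, sub_apply, imMul_apply, smul_eq_mul]
  ring

/-- On $U_\Gamma$ the moving point meets neither pole, so for distinct finite poles the cross-ratio
avoids $0$, $1$ and $\infty$. In the remaining cases the function is identically zero. -/
theorem contDiffOn_omega2 (hΓ : ∞ ∈ limitSet Γ) {γ₁ γ₂ : PSL(2, ℂ)}
    (h₁ : γ₁ ∈ Γ) (h₂ : γ₂ ∈ Γ) :
    ContDiffOn ℝ ((⊤ : ℕ∞) : WithTop ℕ∞) (omega2 γ₁ γ₂) (affineRegion Γ) := by
  rw [omega2_eq]
  refine contDiffOn_form0 (contDiffOn_const.mul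
    (Complex.ofRealCLM.contDiff.comp_contDiffOn (contDiffOn_const.mul ?_)))
  have hne : ∀ γ ∈ Γ, ∀ z ∈ affineRegion Γ, (z : OnePoint ℂ) ≠ γ⁻¹ • ∞ := by
    intro γ hγ z hz h
    have h1 := smul_mem_discontinuityRegion hγ hz
    rw [h, smul_inv_smul] at h1
    exact hΓ h1
  have hne₁ := hne _ (Γ.mul_mem h₁ h₂)
  have hne₂ := hne _ h₂
  generalize (γ₁ * γ₂)⁻¹ • (∞ : OnePoint ℂ) = x at hne₁ ⊢
  generalize γ₂⁻¹ • (∞ : OnePoint ℂ) = y at hne₂ ⊢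
  by_cases hxy : x = y
  · simp only [hxy, crossDilog_eq_zero₂₃]
    exact contDiffOn_const
  cases x with
  | infty =>
    simp only [crossDilog_eq_zero₂₄]
    exact contDiffOn_const
  | coe p =>
    cases y with
    | infty =>
      simp only [crossDilog_eq_zero₃₄]
      exact contDiffOn_const
    | coe q =>
      have hpq : p ≠ q := fun h => hxy (congrArg _ h)
      have hp : ∀ z ∈ affineRegion Γ, z - p ≠ 0 := fun z hz =>
        sub_ne_zero.2 fun h => hne₁ z hz (congrArg _ h)
      have hq : ∀ z ∈ affineRegion Γ, z - q ≠ 0 := fun z hz =>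
        sub_ne_zero.2 fun h => hne₂ z hz (congrArg _ h)
      have h1 : ContDiffOn ℝ ((⊤ : ℕ∞) : WithTop ℕ∞) (fun z : ℂ => (z - p) * (z - q)⁻¹)
          (affineRegion Γ) :=
        (contDiffOn_id.sub contDiffOn_const).mul ((contDiffOn_id.sub contDiffOn_const).inv hq)
      refine (contDiffOn_blochWignerC.comp h1 fun z hz => ?_).congr fun z hz => ?_
      · simp only [mem_compl_iff, mem_insert_iff, mem_singleton_iff, not_or]
        refine ⟨mul_ne_zero (hp z hz) (inv_ne_zero (hq z hz)), fun h => hpq ?_⟩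
        rw [mul_inv_eq_one₀ (hq z hz), sub_right_inj] at h
        exact h
      · rw [crossDilog_coe_infty (sub_ne_zero.1 (hq z hz)), div_eq_mul_inv]
        rfl

/-- `δ ω² = -4 𝓛₂`. -/
theorem coboundary_omega2 (hΓ : ∞ ∈ limitSet Γ) {γ₁ γ₂ γ₃ : PSL(2, ℂ)} (h₃ : γ₃ ∈ Γ) {z : ℂ}
    (hz : z ∈ affineRegion Γ) :
    omega2 γ₂ γ₃ z - omega2 (γ₁ * γ₂) γ₃ z + omega2 γ₁ (γ₂ * γ₃) z -
      pullback γ₃ (omega2 γ₁ γ₂) z = form0 (fun _ => -4 * regulator ![γ₁, γ₂, γ₃]) z := by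
  ext v
  have h := fiveTerm_eq_zero z ((γ₁ * γ₂ * γ₃)⁻¹ • (∞ : OnePoint ℂ))
    ((γ₂ * γ₃)⁻¹ • (∞ : OnePoint ℂ)) (γ₃⁻¹ • (∞ : OnePoint ℂ)) ∞
  -- Applying $\gamma_3^{-1}$ to all four points turns the pulled-back term into the face omitting
  -- $\infty$.
  have h4 : crossDilog (mob γ₃ z) ((γ₁ * γ₂)⁻¹ • (∞ : OnePoint ℂ)) (γ₂⁻¹ • (∞ : OnePoint ℂ)) ∞ =
      crossDilog z ((γ₁ * γ₂ * γ₃)⁻¹ • (∞ : OnePoint ℂ)) ((γ₂ * γ₃)⁻¹ • (∞ : OnePoint ℂ))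
        (γ₃⁻¹ • (∞ : OnePoint ℂ)) := by
    rw [coe_mob hΓ h₃ hz, ← crossDilog_smul γ₃⁻¹, inv_smul_smul]
    simp only [mul_inv_rev, mul_smul]
  simp only [ContinuousAlternatingMap.sub_apply, ContinuousAlternatingMap.add_apply,
    pullback_apply, omega2_eq, form0_apply, h4]
  -- This translation carries the vertices of the regulator to the three poles and $\infty$, giving
  -- the face that omits $z$.
  rw [regulator_eq _ (γ₁ * γ₂ * γ₃)⁻¹]
  have e1 : (γ₁ * γ₂ * γ₃)⁻¹ * γ₁ = (γ₂ * γ₃)⁻¹ := by group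
  have e2 : (γ₂ * γ₃)⁻¹ * γ₂ = γ₃⁻¹ := by group
  simp only [Matrix.cons_val_zero, Matrix.cons_val_one, Matrix.cons_val, e1, e2, inv_mul_cancel,
    one_smul]
  have h' := congrArg (fun x : ℝ => Complex.I * (x : ℂ)) h
  simp only [fiveTerm, ← mul_assoc] at h' ⊢
  push_cast at h' ⊢
  linear_combination 4 * h'

end Region

/-! ### Assembly of the components of the total differential. -/

theorem coboundary_zero_degree {G A : Type*} [Group G] [AddCommGroup A] (act : G → A → A)
    (c : (Fin 0 → G) → A) (g : Fin 1 → G) :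
    coboundary act c g = c ![] - act (g 0) (c ![]) := by
  have e0 : Fin.tail g = ![] := Subsingleton.elim _ _
  have e1 : Fin.init g = ![] := Subsingleton.elim _ _
  rw [coboundary, e0, e1]
  simp [sub_eq_add_neg]

theorem coboundary_one {G A : Type*} [Group G] [AddCommGroup A] (act : G → A → A)
    (c : (Fin 1 → G) → A) (g : Fin 2 → G) :
    coboundary act c g = c ![g 1] - c ![g 0 * g 1] + act (g 1) (c ![g 0]) := by
  have e0 : Fin.tail g = ![g 1] := by
    ext i; fin_cases i; rfl
  have e1 : Fin.contractNth (Fin.castSucc (0 : Fin 1)) (· * ·) g = ![g 0 * g 1] := by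
    ext i; fin_cases i; rfl
  have e2 : Fin.init g = ![g 0] := by
    ext i; fin_cases i; rfl
  rw [coboundary, Fin.sum_univ_one, e0, e1, e2]
  simp [Fin.last, sub_eq_add_neg]

theorem coboundary_two {G A : Type*} [Group G] [AddCommGroup A] (act : G → A → A)
    (c : (Fin 2 → G) → A) (g : Fin 3 → G) :
    coboundary act c g = c ![g 1, g 2] - c ![g 0 * g 1, g 2] + c ![g 0, g 1 * g 2]
      - act (g 2) (c ![g 0, g 1]) := by
  have e0 : Fin.tail g = ![g 1, g 2] := by
    ext i; fin_cases i <;> rfl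
  have e1 : Fin.contractNth (Fin.castSucc (0 : Fin 2)) (· * ·) g = ![g 0 * g 1, g 2] := by
    ext i; fin_cases i <;> rfl
  have e2 : Fin.contractNth (Fin.castSucc (1 : Fin 2)) (· * ·) g = ![g 0, g 1 * g 2] := by
    ext i; fin_cases i <;> rfl
  have e3 : Fin.init g = ![g 0, g 1] := by
    ext i; fin_cases i <;> rfl
  rw [coboundary, Fin.sum_univ_two, e0, e1, e2, e3]
  simp [Fin.last]
  abel

section TotalComplex

variable {Γ : Subgroup PSL(2, ℂ)} {ρ : ℂ → ℝ}

theorem deRham_zero (p q : ℕ) : deRham (0 : Cochain Γ p q) = 0 := by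
  funext g z
  ext v
  simp [deRham, extDeriv, ContinuousAlternatingMap.alternatizeUncurryFin_apply]

theorem cech_zero (p q : ℕ) : cech (0 : Cochain Γ p q) = 0 := by
  funext g z
  ext v
  simp [cech, coboundary, pullback]

theorem deRham_omega0 (c : Cochain Γ 2 0) : deRham c = 0 := by
  funext g z
  exact three_form_eq_zero _

theorem totalD_component_two_one (hΓ : ∞ ∈ limitSet Γ) (hρ : IsConformalMetric Γ ρ)
    (g : Fin 1 → Γ) :
    EqOn (totalD (liouvilleCochain Γ ρ) 2 1 g) 0 (affineRegion Γ) := by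
  intro z hz
  have h := extDeriv_omega1 hΓ hρ (g 0).2 hz
  change extDeriv (omega1 ρ (g 0)) z +
    ((-1 : ℤ) ^ 2 • cech (liouvilleCochain Γ ρ 2 0)) g z = 0
  rw [h, even_two.neg_one_pow, one_smul, cech, coboundary_zero_degree]
  change pullback (g 0 : PSL(2, ℂ)) (omega0 ρ) z - omega0 ρ z +
    (omega0 ρ z - pullback (g 0 : PSL(2, ℂ)) (omega0 ρ) z) = 0
  abel

theorem totalD_component_one_two (hΓ : ∞ ∈ limitSet Γ) (hρ : IsConformalMetric Γ ρ)
    (g : Fin 2 → Γ) :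
    EqOn (totalD (liouvilleCochain Γ ρ) 1 2 g) 0 (affineRegion Γ) := by
  intro z hz
  have h := extDeriv_omega2 hΓ hρ (g 0).2 (g 1).2 hz
  change extDeriv (omega2 (g 0) (g 1)) z +
    ((-1 : ℤ) ^ 1 • cech (liouvilleCochain Γ ρ 1 1)) g z = 0
  rw [h, pow_one, neg_one_smul, cech, Pi.neg_apply, coboundary_one]
  change omega1 ρ (g 1) z - omega1 ρ (g 0 * g 1) z + pullback (g 1 : PSL(2, ℂ)) (omega1 ρ (g 0)) z +
    -(omega1 ρ (g 1) z - omega1 ρ (g 0 * g 1) z +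
      pullback (g 1 : PSL(2, ℂ)) (omega1 ρ (g 0)) z) = 0
  abel

theorem totalD_component_zero_three (hΓ : ∞ ∈ limitSet Γ) (g : Fin 3 → Γ) :
    EqOn (totalD (liouvilleCochain Γ ρ) 0 3 g)
      (form0 fun _ => -4 * regulator fun i => (g i : PSL(2, ℂ))) (affineRegion Γ) := by
  intro z hz
  have h := coboundary_omega2 hΓ (γ₁ := g 0) (γ₂ := g 1) (g 2).2 hz
  have e : (fun i => (g i : PSL(2, ℂ))) = ![(g 0 : PSL(2, ℂ)), g 1, g 2] := by
    ext i; fin_cases i <;> rfl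
  rw [e, ← h]
  change cech (liouvilleCochain Γ ρ 0 2) g z = _
  rw [cech, coboundary_two]
  rfl

theorem totalD_liouvilleCochain (hΓ : ∞ ∈ limitSet Γ) (hρ : IsConformalMetric Γ ρ) :
    AgreeOn (affineRegion Γ) (totalD (liouvilleCochain Γ ρ))
      (constantThreeCochain Γ fun g => -4 * regulator fun i => (g i : PSL(2, ℂ))) := by
  have key : ∀ p q : ℕ, deRham (0 : Cochain Γ p (q + 1)) +
      (-1 : ℤ) ^ (p + 1) • cech (0 : Cochain Γ (p + 1) q) = 0 := fun p q => by
    rw [deRham_zero, cech_zero]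
    funext g z
    ext v
    simp
  rintro p q g
  -- Only total degree three can be nonzero. The components of bidegree $(2,1)$, $(1,2)$ and $(0,3)$
  -- use the three identities, $(3,0)$ vanishes by dimension, and the others are built from zero
  -- cochains.
  match p, q, g with
  | 0, 0, g => exact fun z _ => rfl
  | 0, 1, g => exact fun z _ => congrFun (congrFun (cech_zero (Γ := Γ) 0 0) g) z
  | 0, 2, g => exact fun z _ => congrFun (congrFun (cech_zero (Γ := Γ) 0 1) g) z
  | 0, 3, g => exact totalD_component_zero_three hΓ g
  | 0, q + 4, g => exact fun z _ => congrFun (congrFun (cech_zero (Γ := Γ) 0 (q + 3)) g) z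
  | 1, 0, g => exact fun z _ => congrFun (congrFun (deRham_zero (Γ := Γ) 0 0) g) z
  | 2, 0, g => exact fun z _ => congrFun (congrFun (deRham_zero (Γ := Γ) 1 0) g) z
  | 3, 0, g => exact fun z _ => congrFun (congrFun (deRham_omega0 (Γ := Γ) _) g) z
  | p + 4, 0, g => exact fun z _ => congrFun (congrFun (deRham_zero (Γ := Γ) (p + 3) 0) g) z
  | 1, 1, g => exact fun z _ => congrFun (congrFun (key 0 0) g) z
  | 1, 2, g => exact totalD_component_one_two hΓ hρ g
  | 1, q + 3, g => exact fun z _ => congrFun (congrFun (key 0 (q + 2)) g) z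
  | 2, 1, g => exact totalD_component_two_one hΓ hρ g
  | 2, q + 2, g => exact fun z _ => congrFun (congrFun (key 1 (q + 1)) g) z
  | p + 3, q + 1, g =>
    -- The de Rham term involves the component of bidegree $(p+2,q+1)$, which reduces to $0$ by
    -- definition only once $p$ is known to be zero or a successor.
    cases p with
    | zero => exact fun z _ => congrFun (congrFun (key 2 q) g) z
    | succ p => exact fun z _ => congrFun (congrFun (key (p + 3) q) g) z

theorem isSmoothImaginaryOn_liouvilleCochain (hΓ : ∞ ∈ limitSet Γ) (hρ : IsConformalMetric Γ ρ) :
    IsSmoothImaginaryOn (affineRegion Γ) (liouvilleCochain Γ ρ) := by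
  have hzero : ∀ p : ℕ, ContDiffOn ℝ ((⊤ : ℕ∞) : WithTop ℕ∞) (0 : Form p) (affineRegion Γ) ∧
      ∀ z ∈ affineRegion Γ, ∀ v : Fin p → ℂ, ((0 : Form p) z v).re = 0 :=
    fun p => ⟨contDiffOn_const, fun z _ v => by simp⟩
  rintro p q g
  match p, q, g with
  | 0, 0, g => exact hzero _
  | 0, 1, g => exact hzero _
  | 0, 2, g =>
    refine ⟨contDiffOn_omega2 hΓ (g 0).2 (g 1).2, fun z _ v => ?_⟩
    change (omega2 (g 0) (g 1) z v).re = 0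
    rw [omega2_eq, form0_apply, Complex.re_mul_ofReal, Complex.I_re, zero_mul]
  | 0, q + 3, g => exact hzero _
  | 1, 0, g => exact hzero _
  | 1, 1, g =>
    change ContDiffOn ℝ ((⊤ : ℕ∞) : WithTop ℕ∞) (omega1 ρ (g 0)) (affineRegion Γ) ∧
      ∀ z ∈ affineRegion Γ, ∀ v : Fin 1 → ℂ, (omega1 ρ (g 0) z v).re = 0
    have hg : (g 0 : PSL(2, ℂ)) ∈ Γ := (g 0).2
    obtain ⟨A, hA⟩ := QuotientGroup.mk_surjective (g 0 : PSL(2, ℂ))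
    rw [← hA] at hg ⊢
    have h := omega1_eqOn hΓ hρ hg
    refine ⟨(contDiffOn_form1 (contDiffOn_omegaFunctional hΓ hρ hg)).congr h, fun z hz v => ?_⟩
    rw [h hz, form1_apply, omegaFunctional_apply, Complex.re_mul_ofReal, Complex.I_re, zero_mul]
  | 1, q + 2, g => exact hzero _
  | 2, 0, g =>
    change ContDiffOn ℝ ((⊤ : ℕ∞) : WithTop ℕ∞) (omega0 ρ) (affineRegion Γ) ∧
      ∀ z ∈ affineRegion Γ, ∀ v : Fin 2 → ℂ, (omega0 ρ z v).re = 0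
    have hU := isOpen_affineRegion Γ
    have hlog := Complex.ofRealCLM.contDiff.comp_contDiffOn (contDiffOn_log_metric hρ)
    refine ⟨?_, fun z hz v => ?_⟩
    · exact contDiffOn_const.fun_smul
        (contDiffOn_wedge (contDiffOn_del hU hlog) (contDiffOn_delbar hU hlog))
    · obtain ⟨q, hq⟩ := exists_hasFDerivAt_log_metric hρ hz
      rw [omega0_apply hq, Complex.re_mul_ofReal, Complex.I_re, zero_mul]
  | 2, q + 1, g => exact hzero _
  | p + 3, q, g => exact hzero _

end TotalComplex

end KleinianLiouville

end

open KleinianLiouville in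
theorem mainTheorem10
    (Γ : Subgroup PSL(2, ℂ))
    (hsecond : (discontinuityRegion Γ).Nonempty)
    (hnorm : (∞ : OnePoint ℂ) ∈ limitSet Γ)
    (ρ : ℂ → ℝ) (hρ : IsConformalMetric Γ ρ) :
    IsSmoothImaginaryOn (affineRegion Γ) (liouvilleCochain Γ ρ) ∧
    AgreeOn (affineRegion Γ) (totalD (liouvilleCochain Γ ρ))
      (constantThreeCochain Γ fun g => -4 * regulator fun i => (g i : PSL(2, ℂ))) ∧
    coboundary (fun (_ : PSL(2, ℂ)) (a : ℂ) => a) regulator = 0 :=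
  ⟨isSmoothImaginaryOn_liouvilleCochain hnorm hρ, totalD_liouvilleCochain hnorm hρ,
    coboundary_regulator⟩
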